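/- Throughout, an edge labeling $\lambda$ of a finite poset with minimum $\hat 0$ and maximum $\hat 1$ assigns a nonnegative integer to every covering relation. It is an *$R$-labeling* if every interval has exactly one maximal chain along which the labels weakly increase. For a maximal chain $\mathcal{F}=\{\mathcal{F}_0\prec\cdots\prec\mathcal{F}_n\}$ from $\hat 0$ to $\hat 1$ put $\lambda_i=\lambda(\mathcal{F}_{i-1}\prec\mathcal{F}_i)$, $\mathrm{Des}(\mathcal{F})=\{i : 1\le i\le n-1,\ \lambda_i>\lambda_{i+1}\}$ and $\mathrm{des}(\mathcal{F})=|\mathrm{Des}(\mathcal{F})|$. The descent set is *isolated* if $i\in\mathrm{Des}(\mathcal{F})$ implies $i+1\notin\mathrm{Des}(\mathcal{F})$. (1) Let $M$ be a loopless matroid of rank $n\ge 1$ on a finite ground set $E$. Let $\mathcal{L}(M)$ be its lattice of flats. Let $\underline{\mathsf H}_M(x)=\sum_d \dim_{\mathbb Q}(A^d)\,x^d$ be the Chow polynomial of $M$, that is, the Hilbert–Poincaré series of its Chow ring $$A=\mathbb{Q}[x_F : F\in\mathcal{L}(M),\ F\neq\emptyset]\Big/\Big\langle x_Fx_G\ (F,G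 \text{ incomparable}),\ \sum_{F\ni e}x_F\ (e\in E)\Big\rangle .$$ Then $\mathcal{L}(M)$ admits an $R$-labeling, and for every $R$-labeling $\lambda$ of $\mathcal{L}(M)$ $$\underline{\mathsf H}_M(x)=\sum_{\mathcal F}x^{\mathrm{des}(\mathcal F)}(x+1)^{n-1-2\,\mathrm{des}(\mathcal F)},$$ where the sum ranges over all maximal chains $\mathcal F$ of $\mathcal{L}(M)$ such that $\mathrm{Des}(\mathcal F)$ is isolated and $1\notin\mathrm{Des}(\mathcal F)$. (2) Let $P$ be a finite graded poset with $\hat 0$ and $\hat 1$, of rank $n\ge1$, and let $\mu$ be its Möbius function. For $a<b$ in $P$ let $$\overline\chi_{[a,b]}(x)=\frac{1}{x-1}\sum_{a\le F\le b}\mu(a,F)\,x^{\mathrm{rank}(b)-\mathrm{rank}(F)}$$ be the reduced characteristic polynomial of $[a,b]$. Let $$\underline{\mathsf H}_P(x)=\sum_{\hat0=\mathcal{C}_1<\cdots<\mathcal{C}_{k+1}=\hat1}\ \prod_{i=1}^k\overline\chi_{[\mathcal{C}_i,\mathcal{C}_{i+1}]}(x)$$ be the Chow polynomial of $P$. Then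 for every $R$-labeling $\lambda$ of $P$ one has $$\underline{\mathsf H}_P(x)=\sum_{\mathcal F}x^{\mathrm{des}(\mathcal F)}(x+1)^{n-1-2\,\mathrm{des}(\mathcal F)},$$ with the sum over all maximal chains $\mathcal F$ of $P$ such that $\mathrm{Des}(\mathcal F)$ is isolated and $1\notin\mathrm{Des}(\mathcal F)$. -/

import Mathlib

noncomputable section

open scoped Classical

namespace ChowPoly

/-! ### Saturated chains, edge labelings, descents -/

section Labelings

variable {P : Type*} [PartialOrder P]

/-- `c 0 ⋖ c 1 ⋖ ⋯ ⋖ c k` is a maximal chain of the interval `[a, b]`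
(it starts at `a`, ends at `b`, and every step is a covering relation). -/
def IsMaxChain (a b : P) {k : ℕ} (c : Fin (k + 1) → P) : Prop :=
  c 0 = a ∧ c (Fin.last k) = b ∧ ∀ i : Fin k, c i.castSucc ⋖ c i.succ

/-- The sequence of edge labels along a chain: the entry with (0-based) index `i` is the label of
`c i ⋖ c (i + 1)`. -/
def labels (lam : P → P → ℕ) {k : ℕ} (c : Fin (k + 1) → P) (i : Fin k) : ℕ :=
  lam (c i.castSucc) (c i.succ)

/-- `lam` is an `R`-labeling: every interval `[a, b]` has exactly one maximal chain along which the
labels weakly increase. An edge labeling is given as a function `lam a b`, of which only the values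
at covering pairs `a ⋖ b` are ever used. -/
def IsRLabeling (lam : P → P → ℕ) : Prop :=
  ∀ a b : P, a ≤ b →
    ∃! c : (Σ k : ℕ, Fin (k + 1) → P), IsMaxChain a b c.2 ∧ Monotone (labels lam c.2)

/-- The descent set `{i | 1 ≤ i ≤ n - 1, λ_i > λ_{i+1}}` of a chain `c 0 ⋖ ⋯ ⋖ c n`, where
`λ_i` (for `1 ≤ i ≤ n`) is the label of `c (i - 1) ⋖ c i`. -/
def descents (lam : P → P → ℕ) {n : ℕ} (c : Fin (n + 1) → P) : Finset ℕ :=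
  (Finset.range n).filter fun i =>
    ∃ j k : Fin n, (j : ℕ) + 1 = i ∧ (k : ℕ) = i ∧ labels lam c j > labels lam c k

/-- A set of descents is isolated if it contains no two consecutive integers. -/
def IsIsolated (D : Finset ℕ) : Prop := ∀ i ∈ D, i + 1 ∉ D

/-- `∑_c x ^ des(c) * (x + 1) ^ (n - 1 - 2 des(c))`, the sum over all maximal chains
`c 0 ⋖ ⋯ ⋖ c n` from the minimum to the maximum whose descent set is isolated and does not contain
`1`. (For `n ≥ 1` such a descent set lies in `{2, …, n - 1}` and is isolated, so that
`2 des(c) ≤ n - 1` and the subtraction does not truncate.) -/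
def descentSum [Fintype P] [BoundedOrder P] (lam : P → P → ℕ) (n : ℕ) : Polynomial ℤ :=
  ∑ c : Fin (n + 1) → P with
      IsMaxChain ⊥ ⊤ c ∧ IsIsolated (descents lam c) ∧ 1 ∉ descents lam c,
    Polynomial.X ^ (descents lam c).card *
      (Polynomial.X + 1) ^ (n - 1 - 2 * (descents lam c).card)

end Labelings

/-! ### The Chow polynomial of a finite graded poset

`GradeMinOrder ℕ P` on a finite poset with `⊥` and `⊤` says precisely that `P` is graded, with
`grade ℕ a` the length of every maximal chain from `⊥` to `a`. -/

section Posets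

variable (P : Type*) [PartialOrder P] [Fintype P] [BoundedOrder P] [GradeMinOrder ℕ P]

/-- The rank of a graded poset. -/
def posetRank : ℕ := grade ℕ (⊤ : P)

variable {P}

/-- The Möbius function of a finite poset. -/
def moebius (a b : P) : ℤ :=
  letI : LocallyFiniteOrder P := Fintype.toLocallyFiniteOrder
  IncidenceAlgebra.mu ℤ a b

/-- The characteristic polynomial `∑_{a ≤ F ≤ b} μ(a, F) q ^ (rank b - rank F)` of the interval
`[a, b]`. -/
def charPoly (a b : P) : Polynomial ℤ :=
  ∑ F : P with a ≤ F ∧ F ≤ b,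
    Polynomial.C (moebius a F) * Polynomial.X ^ (grade ℕ b - grade ℕ F)

/-- The reduced characteristic polynomial of `[a, b]`: the quotient by `q - 1`
(for `a < b` the division is exact). -/
def redCharPoly (a b : P) : Polynomial ℤ :=
  charPoly a b /ₘ (Polynomial.X - Polynomial.C 1)

variable (P)

/-- The Chow polynomial of a finite graded poset: `1` in rank `0`, and otherwise the sum, over all
chains `⊥ = c 0 < c 1 < ⋯ < c k = ⊤` (necessarily `k ≤ rank P`), of the products of the reduced
characteristic polynomials of the intervals `[c i, c (i + 1)]`. -/
def chowPolynomial : Polynomial ℤ :=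
  if posetRank P = 0 then 1
  else
    ∑ k ∈ Finset.range (posetRank P + 1),
      ∑ c : Fin (k + 1) → P with StrictMono c ∧ c 0 = ⊥ ∧ c (Fin.last k) = ⊤,
        ∏ i : Fin k, redCharPoly (c i.castSucc) (c i.succ)

end Posets

/-! ### The lattice of flats and the Chow ring of a matroid -/

section Matroids

variable {α : Type*}

/-- The lattice of flats of a matroid, ordered by inclusion. -/
abbrev Flats (M : Matroid α) : Type _ := {F : Set α // M.IsFlat F}

instance (M : Matroid α) : BoundedOrder (Flats M) where
  top := ⟨M.E, M.ground_isFlat⟩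
  le_top F := F.2.subset_ground
  bot := ⟨M.loops, M.isFlat_closure ∅⟩
  bot_le F := F.2.loops_subset

instance (M : Matroid α) [M.Finite] : Finite (Flats M) :=
  Set.Finite.to_subtype (s := {F : Set α | M.IsFlat F})
    (M.ground_finite.finite_subsets.subset fun _ hF => hF.subset_ground)

instance (M : Matroid α) [M.Finite] : Fintype (Flats M) := Fintype.ofFinite _

/-- The index set of the generators of the Chow ring: the nonempty flats. -/
abbrev NonemptyFlats (M : Matroid α) : Type _ := {F : Flats M // F.1.Nonempty}

instance (M : Matroid α) [M.Finite] : Fintype (NonemptyFlats M) := Fintype.ofFinite _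

/-- The defining ideal of the Chow ring of a (loopless) matroid, in the polynomial ring with one
variable `x_F` for each nonempty flat `F`. It is generated by the products `x_F x_G` for
incomparable `F`, `G`, and by the linear forms `∑_{F ∋ e} x_F` for elements `e` of the ground
set. -/
def chowIdeal (M : Matroid α) [M.Finite] : Ideal (MvPolynomial (NonemptyFlats M) ℚ) :=
  Ideal.span
    ({p | ∃ F G : NonemptyFlats M, ¬ F ≤ G ∧ ¬ G ≤ F ∧
        p = MvPolynomial.X F * MvPolynomial.X G} ∪
     {p | ∃ e ∈ M.E, p = ∑ F : NonemptyFlats M with e ∈ F.1.1, MvPolynomial.X F})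

/-- The Chow ring of a (loopless) matroid. -/
abbrev ChowRing (M : Matroid α) [M.Finite] : Type _ :=
  MvPolynomial (NonemptyFlats M) ℚ ⧸ chowIdeal M

/-- The degree `d` part of the Chow ring: the classes of homogeneous polynomials of degree `d`. -/
def chowPiece (M : Matroid α) [M.Finite] (d : ℕ) : Submodule ℚ (ChowRing M) :=
  (MvPolynomial.homogeneousSubmodule (NonemptyFlats M) ℚ d).map
    (Ideal.Quotient.mkₐ ℚ (chowIdeal M)).toLinearMap

/-- The Hilbert-Poincaré series of the Chow ring, as a formal power series. -/
def chowHilbertSeries (M : Matroid α) [M.Finite] : PowerSeries ℤ :=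
  PowerSeries.mk fun d => (Module.finrank ℚ (chowPiece M d) : ℤ)

end Matroids

end ChowPoly

end

/-!
The argument reduces both parts to the recursion `w a = 1 + ∑_{b > a} t(a, b) w b`, where
`t(a, b) = x + x² + ⋯ + x^(r-1)` with `r = rank b - rank a` (`gapPoly`); such a recursion has only
one solution.

*Descent sums.* Let `w a` be the descent sum of the interval `[a, ⊤]`. The weight
`x^des (x+1)^(n-1-2des)` of a label sequence satisfies a sequence identity (`weight_eq`): it is the
sum over all nonempty increasing initial segments, of length `j`, of `x + ⋯ + x^(j-1)` times the
weight of the rest, plus `1` if the whole sequence increases. An `R`-labeling has exactly one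
increasing chain in `[a, b]`, so summing the identity over all maximal chains of `[a, ⊤]` gives the
recursion (`IsRLabeling.upperDescentSum_eq`).

*Chow polynomials.* The Chow polynomial of `[a, ⊤]` is determined by the recursion
`w a = ∑_{b > a} χ̄(a, b) w b` with `w ⊤ = 1`. After multiplication by `x - 1`, Möbius inversion
shows that a solution of the first recursion solves this one (`eq_sum_redCharPoly_mul`).

*Chow rings.* The monomials `∏ x_{Fᵢ}^{aᵢ}` with `F₁ < ⋯ < Fₖ` and
`1 ≤ aᵢ < rank Fᵢ - rank Fᵢ₋₁` (Feichtner–Yuzvinsky) form a basis of the Chow ring; splitting off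
the power of the smallest flat shows that they are counted by the same recursion (`fyPoly_eq`).

They span because `x_a h_F^r = 0` for `a < F`, `r = rank F - rank a` and `h_F = ∑_{H ≥ F} x_H`
(`IsChowFamily.mul_upperSum_pow_grade`): this relation replaces a monomial that is divisible by
`x_a x_F^r` by monomials in larger flats (`IsChowFamily.monomialValue_mem_span`).

They are independent because of the degree maps `degreeMap a` of the intervals `[a, ⊤]`. These are
defined on monomials by recursion on the smallest flat, through the formula that the restriction to
the divisor of that flat would give. That the formula respects the linear relations comes down to
Pascal's rule and to the fact that exactly one cover of `a` contains a given element outside `a`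
(`degreeMap_mul_linForm`). The degree pairing is triangular on the monomials above: if `F` is
minimal among the smallest flats of the monomials of `p`, and `i` is the largest exponent of such an
`F`, then pairing `p` with multiples of `x_F^(r-i)` isolates the monomials that begin with `x_F^i`,
and the pairing becomes one on `[F, ⊤]` (`eq_zero_of_degreeMap_mul_eq_zero`).

*Existence of an `R`-labeling.* Number the ground set and label `F ⋖ G` by the smallest number in
`G \ F`: an increasing chain of `[F, G]` must adjoin the smallest element of `G \ F` first
(`isRLabeling_minLabeling`).
-/

noncomputable section

open scoped Classical

namespace ChowPoly

/-! ### Sums over maximal chains -/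

section ChainSums

variable {P : Type*}

lemma labels_cons {q : P} {n : ℕ} {c : Fin (n + 1) → P} :
    List.ofFn (labels lam (Fin.cons q c : Fin (n + 2) → P)) =
      lam q (c 0) :: List.ofFn (labels lam c) := by
  rw [List.ofFn_succ]
  congr 1

lemma monotone_labels_iff {lam : P → P → ℕ} {k : ℕ} {c : Fin (k + 1) → P} :
    Monotone (labels lam c) ↔ (List.ofFn (labels lam c)).IsChain (· ≤ ·) := by
  rw [List.isChain_iff_pairwise, List.pairwise_ofFn]
  constructor
  · intro h i j hij; exact h hij.le
  · intro h i j hij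
    rcases hij.eq_or_lt with rfl | hlt
    · exact le_rfl
    · exact h hlt

variable [PartialOrder P]

lemma isMaxChain_cons {a b q : P} {n : ℕ} {c : Fin (n + 1) → P} :
    IsMaxChain a b (Fin.cons q c : Fin (n + 2) → P) ↔ q = a ∧ q ⋖ c 0 ∧ IsMaxChain (c 0) b c := by
  unfold IsMaxChain
  rw [Fin.forall_fin_succ, ← Fin.succ_last]
  simp only [Fin.cons_zero, Fin.cons_succ, Fin.castSucc_zero, ← Fin.succ_castSucc]
  tauto

variable [Fintype P] {R : Type*} [CommSemiring R]

/-- The sum, over all maximal chains of `[a, b]` of length `n`, of a function of the list of edge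
labels along the chain. -/
def chainSum (lam : P → P → ℕ) (n : ℕ) (a b : P) (f : List ℕ → R) : R :=
  ∑ c : Fin (n + 1) → P with IsMaxChain a b c, f (List.ofFn (labels lam c))

variable {lam : P → P → ℕ}

lemma chainSum_zero (a b : P) (f : List ℕ → R) :
    chainSum lam 0 a b f = if a = b then f [] else 0 := by
  unfold chainSum
  rw [Finset.sum_filter, Fintype.sum_equiv (Equiv.funUnique (Fin 1) P) _
    (fun p => if p = a ∧ p = b then f [] else 0)]
  · by_cases h : a = b
    · subst h; simp
    · rw [if_neg h]
      refine Finset.sum_eq_zero fun p _ => if_neg ?_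
      rintro ⟨rfl, rfl⟩; exact h rfl
  · intro c
    simp [IsMaxChain, Fin.last]

lemma chainSum_succ (n : ℕ) (a b : P) (f : List ℕ → R) :
    chainSum lam (n + 1) a b f =
      ∑ p with a ⋖ p, chainSum lam n p b (fun l => f (lam a p :: l)) := by
  unfold chainSum
  rw [Finset.sum_filter, ← (Fin.consEquiv fun _ => P).sum_comp, Fintype.sum_prod_type,
    Finset.sum_comm]
  have h1 : ∀ c : Fin (n + 1) → P, (∑ q : P, if IsMaxChain a b (Fin.consEquiv (fun _ => P) (q, c))
        then f (List.ofFn (labels lam (Fin.consEquiv (fun _ => P) (q, c)))) else 0) =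
      if a ⋖ c 0 ∧ IsMaxChain (c 0) b c then f (lam a (c 0) :: List.ofFn (labels lam c))
        else 0 := by
    intro c
    rw [Finset.sum_eq_single a]
    · simp only [Fin.consEquiv, Equiv.coe_fn_mk, isMaxChain_cons, labels_cons, true_and]
    · intro q _ hq
      simp [Fin.consEquiv, isMaxChain_cons, hq]
    · simp
  rw [Finset.sum_congr rfl fun c _ => h1 c]
  simp only [Finset.sum_filter]
  have h2 : ∀ p : P, (if a ⋖ p then ∑ c : Fin (n + 1) → P,
      (if IsMaxChain p b c then f (lam a p :: List.ofFn (labels lam c)) else 0) else 0) =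
      ∑ c : Fin (n + 1) → P, if p = c 0 then
        (if a ⋖ c 0 ∧ IsMaxChain (c 0) b c then f (lam a (c 0) :: List.ofFn (labels lam c)) else 0)
        else 0 := by
    intro p
    by_cases hp : a ⋖ p
    · rw [if_pos hp]
      refine Finset.sum_congr rfl fun c _ => ?_
      by_cases hc : p = c 0
      · subst hc; simp [hp]
      · rw [if_neg hc, if_neg fun h => hc h.1.symm]
    · rw [if_neg hp]
      refine (Finset.sum_eq_zero fun c _ => ?_).symm
      split_ifs with h1 h2
      · exact absurd (h1 ▸ h2.1) hp
      · rfl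
      · rfl
  rw [Finset.sum_congr rfl fun p _ => h2 p, Finset.sum_comm]
  simp

lemma chainSum_congr {n : ℕ} {a b : P} {f g : List ℕ → R}
    (h : ∀ c : Fin (n + 1) → P, IsMaxChain a b c →
      f (List.ofFn (labels lam c)) = g (List.ofFn (labels lam c))) :
    chainSum lam n a b f = chainSum lam n a b g :=
  Finset.sum_congr rfl fun c hc => h c (Finset.mem_filter.1 hc).2

lemma chainSum_congr_length {n : ℕ} {a b : P} {f g : List ℕ → R}
    (h : ∀ l : List ℕ, l.length = n → f l = g l) :
    chainSum lam n a b f = chainSum lam n a b g :=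
  chainSum_congr fun _ _ => h _ (by simp)

lemma chainSum_add (n : ℕ) (a b : P) (f g : List ℕ → R) :
    chainSum lam n a b (fun l => f l + g l) = chainSum lam n a b f + chainSum lam n a b g :=
  Finset.sum_add_distrib

lemma chainSum_sum {ι : Type*} (s : Finset ι) (n : ℕ) (a b : P) (f : ι → List ℕ → R) :
    chainSum lam n a b (fun l => ∑ i ∈ s, f i l) = ∑ i ∈ s, chainSum lam n a b (f i) :=
  Finset.sum_comm

lemma mul_chainSum (r : R) (n : ℕ) (a b : P) (f : List ℕ → R) :
    chainSum lam n a b (fun l => r * f l) = r * chainSum lam n a b f :=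
  (Finset.mul_sum _ _ _).symm

/-- Cutting a maximal chain after `j` steps: the label list is cut at the same place. -/
lemma sum_chainSum_mul_chainSum (j k : ℕ) (a t : P) (f g : List ℕ → R) :
    ∑ b, chainSum lam j a b f * chainSum lam k b t g =
      chainSum lam (j + k) a t (fun l => f (l.take j) * g (l.drop j)) := by
  induction j generalizing a f with
  | zero =>
    simp only [chainSum_zero, ite_mul, zero_mul, Finset.sum_ite_eq, Finset.mem_univ, if_true,
      List.take_zero, List.drop_zero, zero_add, mul_chainSum]
  | succ j ih =>
    rw [show j + 1 + k = (j + k) + 1 by ring, chainSum_succ]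
    simp only [chainSum_succ, Finset.sum_mul]
    rw [Finset.sum_comm]
    refine Finset.sum_congr rfl fun p _ => ?_
    rw [ih]
    simp

end ChainSums

/-! ### Chains and `R`-labelings in graded posets -/

section Graded

/-- The indicator of the weakly increasing lists. -/
def incr (R : Type*) [CommSemiring R] (l : List ℕ) : R := if l.IsChain (· ≤ ·) then 1 else 0

variable {P : Type*} [PartialOrder P] {lam : P → P → ℕ}

lemma IsMaxChain.le {a b : P} {k : ℕ} {c : Fin (k + 1) → P} (h : IsMaxChain a b c) : a ≤ b := by
  have : Monotone c := Fin.monotone_iff_le_succ.2 fun i => (h.2.2 i).le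
  rw [← h.1, ← h.2.1]; exact this (Fin.zero_le _)

lemma IsMaxChain.grade_add [GradeOrder ℕ P] {a b : P} {k : ℕ} {c : Fin (k + 1) → P}
    (h : IsMaxChain a b c) : grade ℕ a + k = grade ℕ b := by
  have key : ∀ i : Fin (k + 1), grade ℕ (c i) = grade ℕ a + i := by
    intro i
    induction i using Fin.induction with
    | zero => simp [h.1]
    | succ i ih =>
      have := (h.2.2 i).grade ℕ
      rw [Order.covBy_iff_add_one_eq] at this
      rw [← this, ih]; simp; ring
  rw [← h.2.1, key]; simp

variable [Fintype P] {R : Type*} [CommSemiring R]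

lemma chainSum_eq_zero_of_not_le {n : ℕ} {a b : P} {f : List ℕ → R}
    (h : ¬ a ≤ b) : chainSum lam n a b f = 0 :=
  Finset.sum_eq_zero fun _ hc => absurd (Finset.mem_filter.1 hc).2.le h

lemma chainSum_incr (n : ℕ) (a b : P) : chainSum lam n a b (incr R) =
    ((Finset.univ.filter fun c : Fin (n + 1) → P =>
      IsMaxChain a b c ∧ Monotone (labels lam c)).card : R) := by
  unfold chainSum incr
  rw [← Finset.filter_filter, Finset.card_filter, Nat.cast_sum]
  refine Finset.sum_congr rfl fun c _ => ?_
  simp only [monotone_labels_iff]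
  split_ifs <;> simp

variable [GradeOrder ℕ P]

lemma chainSum_eq_zero_of_grade {n : ℕ} {a b : P} {f : List ℕ → R}
    (h : grade ℕ a + n ≠ grade ℕ b) : chainSum lam n a b f = 0 :=
  Finset.sum_eq_zero fun _ hc => absurd (Finset.mem_filter.1 hc).2.grade_add h

/-- In a graded poset the `R`-labelings are the labelings with exactly one increasing chain, among
the chains of the only possible length, in every interval. -/
lemma isRLabeling_iff_chainSum : IsRLabeling lam ↔
    ∀ a b : P, a ≤ b → chainSum lam (grade ℕ b - grade ℕ a) a b (incr ℕ) = 1 := by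
  refine forall₃_congr fun a b hab => ?_
  rw [chainSum_incr, Nat.cast_id, Finset.card_eq_one]
  constructor
  · rintro ⟨⟨k, c⟩, ⟨hc, hm⟩, huniq⟩
    have hk : k = grade ℕ b - grade ℕ a := by
      have : grade ℕ a + k = grade ℕ b := hc.grade_add
      omega
    subst hk
    refine ⟨c, Finset.eq_singleton_iff_unique_mem.2 ⟨by simp [hc, hm], fun d hd => ?_⟩⟩
    have := huniq ⟨_, d⟩ (Finset.mem_filter.1 hd).2
    simpa using this
  · rintro ⟨c, hc⟩
    have hc' := Finset.eq_singleton_iff_unique_mem.1 hc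
    refine ⟨⟨_, c⟩, (Finset.mem_filter.1 hc'.1).2, ?_⟩
    rintro ⟨k, d⟩ hd
    have hk : k = grade ℕ b - grade ℕ a := by
      have : grade ℕ a + k = grade ℕ b := hd.1.grade_add
      omega
    subst hk
    rw [hc'.2 d (by simpa using hd)]

lemma IsRLabeling.chainSum_incr_eq_one (h : IsRLabeling lam) {a b : P} (hab : a ≤ b) :
    chainSum lam (grade ℕ b - grade ℕ a) a b (incr R) = 1 := by
  have h1 := isRLabeling_iff_chainSum.1 h a b hab
  rw [chainSum_incr, Nat.cast_id] at h1
  rw [chainSum_incr, h1, Nat.cast_one]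

end Graded

/-! ### The weight of a label sequence -/

section Weight

open Polynomial

/-- The weight of the label sequence `a :: l`, read from left to right: every ascent contributes
`X + 1`, and every descent turns the factor `X + 1` of the ascent before it into `X`. The flag `s`
records that the factor of an ascent immediately before `a` is still to be accounted for; a descent
without such an ascent makes the weight vanish. -/
def stepWeight : Bool → ℕ → List ℕ → ℤ[X]
  | s, _, [] => if s then X + 1 else 1
  | s, a, b :: l =>
    if a ≤ b then (if s then (X + 1) * stepWeight true b l else stepWeight true b l)
    else (if s then X * stepWeight false b l else 0)

/-- The contribution `x ^ des * (x + 1) ^ (n - 1 - 2 des)` of a label sequence to the descent sum,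
which is `0` if the descent set is not isolated or contains `1` (see `weight_ofFn_labels`). -/
def weight : List ℕ → ℤ[X]
  | [] => 1
  | a :: l => stepWeight false a l

/-- The polynomial `x + x ^ 2 + ⋯ + x ^ (m - 1)`. -/
def gapPoly (m : ℕ) : ℤ[X] := ∑ i ∈ Finset.Ico 1 m, X ^ i

lemma gapPoly_one : gapPoly 1 = 0 := by simp [gapPoly]

lemma gapPoly_add_two (m : ℕ) : gapPoly (m + 2) = X * gapPoly (m + 1) + X := by
  unfold gapPoly
  rw [Finset.sum_eq_sum_Ico_succ_bot (by omega), Finset.mul_sum, pow_one, add_comm]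
  rw [Finset.sum_Ico_eq_sum_range, Finset.sum_Ico_eq_sum_range]
  congr 1
  refine Finset.sum_congr (by simp) fun i _ => ?_
  ring

lemma X_sub_one_mul_gapPoly {m : ℕ} (hm : 1 ≤ m) : (X - 1) * gapPoly m = X ^ m - X := by
  induction m, hm using Nat.le_induction with
  | base => simp [gapPoly_one]
  | succ m hm ih =>
    obtain ⟨k, rfl⟩ : ∃ k, m = k + 1 := ⟨m - 1, by omega⟩
    rw [gapPoly_add_two, mul_add, mul_left_comm, ih]; ring

lemma incr_cons_cons (a b : ℕ) (l : List ℕ) :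
    incr ℤ[X] (a :: b :: l) = if a ≤ b then incr ℤ[X] (b :: l) else 0 := by
  unfold incr
  by_cases h : a ≤ b <;> simp [h]

/-- The two states are treated together, as a descent leads back from `true` to `false`. The case of
`false` is the identity `weight_eq`. -/
lemma stepWeight_eq (a : ℕ) (l : List ℕ) :
    stepWeight false a l = incr ℤ[X] (a :: l) + ∑ j ∈ Finset.range (l.length + 1),
        incr ℤ[X] (a :: l.take j) * (gapPoly (j + 1) * weight (l.drop j)) ∧
    stepWeight true a l = incr ℤ[X] (a :: l) + X * ∑ j ∈ Finset.range (l.length + 1),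
        incr ℤ[X] (a :: l.take j) * (gapPoly (j + 1) * weight (l.drop j)) +
      X * ∑ j ∈ Finset.range (l.length + 1),
        incr ℤ[X] (a :: l.take j) * weight (l.drop j) := by
  induction l generalizing a with
  | nil => simp [stepWeight, incr, gapPoly_one, weight]; ring
  | cons b l ih =>
    obtain ⟨ihF, ihG⟩ := ih b
    set U := ∑ j ∈ Finset.range (l.length + 1),
        incr ℤ[X] (b :: l.take j) * (gapPoly (j + 1) * weight (l.drop j)) with hU
    set V := ∑ j ∈ Finset.range (l.length + 1),
        incr ℤ[X] (b :: l.take j) * weight (l.drop j) with hV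
    have h1 : incr ℤ[X] [a] = 1 := by simp [incr]
    have hU' : ∑ j ∈ Finset.range ((b :: l).length + 1),
        incr ℤ[X] (a :: (b :: l).take j) * (gapPoly (j + 1) * weight ((b :: l).drop j)) =
        if a ≤ b then X * U + X * V else 0 := by
      rw [List.length_cons, Finset.sum_range_succ']
      simp only [List.take_succ_cons, List.drop_succ_cons, incr_cons_cons, zero_add, gapPoly_one,
        zero_mul, mul_zero, add_zero]
      split_ifs
      · rw [hU, hV, Finset.mul_sum, Finset.mul_sum, ← Finset.sum_add_distrib]
        refine Finset.sum_congr rfl fun j _ => ?_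
        rw [gapPoly_add_two]; ring
      · simp
    have hV' : ∑ j ∈ Finset.range ((b :: l).length + 1),
        incr ℤ[X] (a :: (b :: l).take j) * weight ((b :: l).drop j) =
        (if a ≤ b then V else 0) + stepWeight false b l := by
      rw [List.length_cons, Finset.sum_range_succ']
      simp only [List.take_succ_cons, List.drop_succ_cons, incr_cons_cons, List.take_zero,
        List.drop_zero, h1, one_mul, weight]
      congr 1
      split_ifs
      · rfl
      · simp
    rw [hU', hV', incr_cons_cons]
    by_cases hab : a ≤ b
    · simp only [stepWeight, hab, if_true, Bool.false_eq_true, if_false]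
      refine ⟨by rw [ihG]; ring, ?_⟩
      rw [ihF, add_mul, ihG]; ring
    · simp [stepWeight, hab]

/-- Splitting off a nonempty increasing initial segment in all possible ways. -/
lemma weight_eq (l : List ℕ) : weight l = incr ℤ[X] l + ∑ j ∈ Finset.range l.length,
    incr ℤ[X] (l.take (j + 1)) * (gapPoly (j + 1) * weight (l.drop (j + 1))) := by
  cases l with
  | nil => simp [weight, incr]
  | cons a l => simpa [weight] using (stepWeight_eq a l).1

/-- The descent set of a list, with the positions numbered from `1`. -/
def listDescents : List ℕ → Finset ℕ
  | [] => ∅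
  | [_] => ∅
  | a :: b :: l => (if a ≤ b then ∅ else {1}) ∪
      (listDescents (b :: l)).map (addRightEmbedding 1)

lemma mem_listDescents {l : List ℕ} {i : ℕ} :
    i ∈ listDescents l ↔ ∃ j, j + 1 = i ∧ ∃ h : j + 1 < l.length, l[j + 1] < l[j] := by
  induction l generalizing i with
  | nil => simp [listDescents]
  | cons a l ih =>
    cases l with
    | nil => simp [listDescents]
    | cons b l =>
      rw [listDescents, Finset.mem_union, Finset.mem_map]
      simp only [ih, addRightEmbedding_apply]
      constructor
      · rintro (h | ⟨_, ⟨j, rfl, h, hj⟩, rfl⟩)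
        · split_ifs at h with hab
          · simp at h
          · exact ⟨0, by simpa using (Finset.mem_singleton.1 h).symm, by simp, by simpa using hab⟩
        · exact ⟨j + 1, rfl, by simpa using h, by simpa using hj⟩
      · rintro ⟨j, rfl, h, hj⟩
        cases j with
        | zero =>
          left
          rw [if_neg (by simpa using hj)]; simp
        | succ j => exact Or.inr ⟨j + 1, ⟨j, rfl, by simpa using h, by simpa using hj⟩, rfl⟩

lemma zero_notMem_listDescents (l : List ℕ) : 0 ∉ listDescents l := by
  simp [mem_listDescents]

lemma isIsolated_map_succ {D : Finset ℕ} :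
    IsIsolated (D.map (addRightEmbedding 1)) ↔ IsIsolated D := by
  simp [IsIsolated]

lemma isIsolated_insert_map_succ {D : Finset ℕ} (h0 : 0 ∉ D) :
    IsIsolated ({1} ∪ D.map (addRightEmbedding 1)) ↔ IsIsolated D ∧ 1 ∉ D := by
  have hn : ∀ i ∈ D, i ≠ 0 := fun i hi h => h0 (h ▸ hi)
  constructor
  · intro h
    refine ⟨fun i hi hi' => h (i + 1) (by simp [hi]) (by simp [hi']), fun h1 => h 1 (by simp) ?_⟩
    simp [h1]
  · rintro ⟨h, h1⟩ i hi
    simp only [Finset.mem_union, Finset.mem_singleton, Finset.mem_map,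
      addRightEmbedding_apply] at hi
    rcases hi with rfl | ⟨j, hj, rfl⟩
    · simp [h1]
    · simp [h j hj, hn j hj]

/-- The bounds on the number of descents say that the exponents of `X + 1` do not truncate. -/
lemma stepWeight_eq_listDescents (a : ℕ) (l : List ℕ) :
    ((IsIsolated (listDescents (a :: l)) → 2 * (listDescents (a :: l)).card ≤ l.length + 1) ∧
    (IsIsolated (listDescents (a :: l)) → 1 ∉ listDescents (a :: l) →
      2 * (listDescents (a :: l)).card ≤ l.length)) ∧
    stepWeight false a l = (if IsIsolated (listDescents (a :: l)) ∧ 1 ∉ listDescents (a :: l) then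
      X ^ (listDescents (a :: l)).card *
        (X + 1) ^ (l.length - 2 * (listDescents (a :: l)).card) else 0) ∧
    stepWeight true a l = (if IsIsolated (listDescents (a :: l)) then
      X ^ (listDescents (a :: l)).card *
        (X + 1) ^ (l.length + 1 - 2 * (listDescents (a :: l)).card) else 0) := by
  induction l generalizing a with
  | nil => simp [listDescents, stepWeight, IsIsolated]
  | cons b l ih =>
    obtain ⟨⟨h1, h2⟩, hF, hG⟩ := ih b
    have h0 := zero_notMem_listDescents (b :: l)
    set D := listDescents (b :: l) with hD
    have hD' : listDescents (a :: b :: l) =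
      (if a ≤ b then ∅ else {1}) ∪ D.map (addRightEmbedding 1) := rfl
    by_cases hab : a ≤ b
    · rw [if_pos hab, Finset.empty_union] at hD'
      have hm : 1 ∉ D.map (addRightEmbedding 1) := by simp [h0]
      simp only [hD', isIsolated_map_succ, Finset.card_map, List.length_cons, stepWeight, hab,
        if_true, Bool.false_eq_true, if_false, hG]
      refine ⟨⟨fun h => (h1 h).trans (by omega), fun h _ => h1 h⟩, ?_, ?_⟩
      · simp [hm]
      · split_ifs with h
        · have := h1 h
          rw [show l.length + 1 + 1 - 2 * D.card = (l.length + 1 - 2 * D.card) + 1 by omega]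
          ring
        · simp
    · rw [if_neg hab] at hD'
      have hm : 1 ∈ {1} ∪ D.map (addRightEmbedding 1) := by simp
      have hcard : (({1} : Finset ℕ) ∪ D.map (addRightEmbedding 1)).card = D.card + 1 := by
        rw [Finset.card_union_of_disjoint (by simp [h0]), Finset.card_map, Finset.card_singleton,
          add_comm]
      simp only [hD', isIsolated_insert_map_succ h0, hcard, List.length_cons, stepWeight, hab,
        if_true, Bool.false_eq_true, if_false, hF, hm, not_true, and_false]
      refine ⟨⟨fun h => ?_, fun _ h => h.elim⟩, trivial, ?_⟩
      · have := h2 h.1 h.2; omega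
      · split_ifs with h
        · rw [show l.length + 1 + 1 - 2 * (D.card + 1) = l.length - 2 * D.card by omega]
          ring
        · simp

lemma descents_eq_listDescents {P : Type*} (lam : P → P → ℕ) {n : ℕ} (c : Fin (n + 1) → P) :
    descents lam c = listDescents (List.ofFn (labels lam c)) := by
  ext i
  simp only [descents, Finset.mem_filter, Finset.mem_range, mem_listDescents, List.length_ofFn,
    List.getElem_ofFn]
  constructor
  · rintro ⟨hi, j, k, hj, hk, h⟩
    refine ⟨j, hj, by omega, ?_⟩
    convert h using 2
    ext; simp; omega
  · rintro ⟨j, rfl, hj, h⟩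
    exact ⟨hj, ⟨j, by omega⟩, ⟨j + 1, hj⟩, rfl, rfl, h⟩

lemma weight_ofFn_labels {P : Type*} (lam : P → P → ℕ) {n : ℕ} (c : Fin (n + 1) → P) :
    weight (List.ofFn (labels lam c)) =
      if IsIsolated (descents lam c) ∧ 1 ∉ descents lam c then
        X ^ (descents lam c).card * (X + 1) ^ (n - 1 - 2 * (descents lam c).card) else 0 := by
  rw [descents_eq_listDescents]
  have hn : (List.ofFn (labels lam c)).length = n := List.length_ofFn
  generalize List.ofFn (labels lam c) = l at hn
  subst hn
  cases l with
  | nil => simp [weight, listDescents, IsIsolated]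
  | cons a l => simpa [weight] using (stepWeight_eq_listDescents a l).2.1

end Weight

/-! ### The recursion of the descent sums -/

section Recursion

open Polynomial

variable {P : Type*} [PartialOrder P] [Fintype P] [BoundedOrder P]

lemma descentSum_eq_chainSum (lam : P → P → ℕ) (n : ℕ) :
    descentSum lam n = chainSum lam n ⊥ ⊤ weight := by
  unfold descentSum chainSum
  rw [← Finset.filter_filter, Finset.sum_filter]
  exact Finset.sum_congr rfl fun c _ => (weight_ofFn_labels lam c).symm

variable [GradeMinOrder ℕ P]

/-- The descent sum of the interval `[a, ⊤]`. -/
def upperDescentSum (lam : P → P → ℕ) (a : P) : ℤ[X] :=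
  chainSum lam (grade ℕ (⊤ : P) - grade ℕ a) a ⊤ weight

lemma descentSum_eq_upperDescentSum (lam : P → P → ℕ) :
    descentSum lam (posetRank P) = upperDescentSum lam ⊥ := by
  rw [descentSum_eq_chainSum, upperDescentSum, grade_bot, posetRank]
  rfl

variable {lam : P → P → ℕ}

/-- A maximal chain of `[a, ⊤]` with an increasing initial segment ending in `b` is a maximal chain
of `[b, ⊤]`, since `[a, b]` has only one increasing maximal chain. -/
theorem IsRLabeling.upperDescentSum_eq (h : IsRLabeling lam) (a : P) :
    upperDescentSum lam a =
      1 + ∑ b with a < b, gapPoly (grade ℕ b - grade ℕ a) * upperDescentSum lam b := by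
  have hg : ∀ x y : P, x < y → grade ℕ x < grade ℕ y := fun x y hxy => grade_strictMono hxy
  set m := grade ℕ (⊤ : P) - grade ℕ a with hm
  have h1 : upperDescentSum lam a = chainSum lam m a ⊤ (fun l => incr ℤ[X] l +
      ∑ j ∈ Finset.range m, incr ℤ[X] (l.take (j + 1)) *
        (gapPoly (j + 1) * weight (l.drop (j + 1)))) :=
    chainSum_congr_length fun l hl => by rw [weight_eq, hl]
  rw [h1, chainSum_add, h.chainSum_incr_eq_one le_top, chainSum_sum]
  congr 1
  have h2 : ∀ j ∈ Finset.range m, chainSum lam m a ⊤ (fun l => incr ℤ[X] (l.take (j + 1)) *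
        (gapPoly (j + 1) * weight (l.drop (j + 1)))) =
      ∑ b with a < b, if grade ℕ b - grade ℕ a = j + 1 then
        gapPoly (grade ℕ b - grade ℕ a) * upperDescentSum lam b else 0 := by
    intro j hj
    rw [Finset.mem_range] at hj
    have h3 := sum_chainSum_mul_chainSum (lam := lam) (j + 1) (m - (j + 1)) a ⊤ (incr ℤ[X])
      (fun l => gapPoly (j + 1) * weight l)
    rw [show j + 1 + (m - (j + 1)) = m by omega] at h3
    rw [← h3, Finset.sum_filter]
    refine Finset.sum_congr rfl fun b _ => ?_
    by_cases hab : a < b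
    · have hab' := hg _ _ hab
      have hb' : grade ℕ b ≤ grade ℕ (⊤ : P) := grade_mono le_top
      rw [if_pos hab]
      split_ifs with hj'
      · rw [← hj', h.chainSum_incr_eq_one hab.le, mul_chainSum, one_mul, upperDescentSum]
        rw [show m - (grade ℕ b - grade ℕ a) = grade ℕ (⊤ : P) - grade ℕ b by omega]
      · rw [chainSum_eq_zero_of_grade (by omega), zero_mul]
    · rw [if_neg hab]
      by_cases hab' : a ≤ b
      · obtain rfl : a = b := hab'.eq_of_not_lt hab
        rw [chainSum_eq_zero_of_grade (by omega), zero_mul]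
      · rw [chainSum_eq_zero_of_not_le hab', zero_mul]
  rw [Finset.sum_congr rfl h2, Finset.sum_comm]
  refine Finset.sum_congr rfl fun b hb => ?_
  have hab' := hg _ _ (Finset.mem_filter.1 hb).2
  have hb' : grade ℕ b ≤ grade ℕ (⊤ : P) := grade_mono le_top
  rw [Finset.sum_eq_single (grade ℕ b - grade ℕ a - 1)]
  · rw [if_pos (by omega)]
  · intro j _ hj; rw [if_neg (by omega)]
  · intro hj; rw [Finset.mem_range] at hj; omega

end Recursion

/-! ### The Chow polynomial of a graded poset -/

section ChowPolynomial

open Polynomial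

variable {P : Type*} [PartialOrder P] [Fintype P]

lemma ite_finsetSum {ι R : Type*} [AddCommMonoid R] (p : Prop) (s : Finset ι) (f : ι → R) :
    (if p then ∑ i ∈ s, f i else 0) = ∑ i ∈ s, if p then f i else 0 := by
  split_ifs <;> simp

lemma sum_moebius (a b : P) :
    ∑ F with a ≤ F ∧ F ≤ b, moebius a F = if a = b then 1 else 0 := by
  let _ : LocallyFiniteOrder P := Fintype.toLocallyFiniteOrder
  have := IncidenceAlgebra.sum_Icc_mu_right (𝕜 := ℤ) a b
  rw [← this]
  refine Finset.sum_congr ?_ fun F _ => ?_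
  · ext; simp
  · unfold moebius; congr 1

section

variable [GradeMinOrder ℕ P]

lemma X_sub_one_mul_redCharPoly {a b : P} (hab : a < b) :
    (X - 1) * redCharPoly a b = charPoly a b := by
  have h0 : (charPoly a b).IsRoot 1 := by
    have := sum_moebius a b
    rw [if_neg hab.ne] at this
    simpa [charPoly, Polynomial.eval_finsetSum, Polynomial.IsRoot] using this
  have := mul_divByMonic_eq_iff_isRoot.2 h0
  simpa [redCharPoly] using this

lemma charPoly_self (a : P) : charPoly a a = 1 := by
  have : (Finset.univ.filter fun F : P => a ≤ F ∧ F ≤ a) = {a} := by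
    ext F; simp [le_antisymm_iff, and_comm]
  have h := sum_moebius a a
  rw [this, Finset.sum_singleton, if_pos rfl] at h
  rw [charPoly, this, Finset.sum_singleton, h]; simp

variable [BoundedOrder P]

/-- Möbius inversion turns the recursion of `IsRLabeling.upperDescentSum_eq` into the recursion of
the Chow polynomials of the intervals `[a, ⊤]`. -/
lemma eq_sum_redCharPoly_mul {w : P → ℤ[X]}
    (hw : ∀ a, w a = 1 + ∑ b with a < b, gapPoly (grade ℕ b - grade ℕ a) * w b)
    {a : P} (ha : a < ⊤) : w a = ∑ b with a < b, redCharPoly a b * w b := by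
  -- Multiplied by `X - 1`, the recursion for `w` expresses `∑ X ^ rank(F, b) * w b`.
  have h1 : ∀ F : P, ∑ b with F ≤ b, X ^ (grade ℕ b - grade ℕ F) * w b =
      X * (∑ b with F ≤ b, w b) - (X - 1) := by
    intro F
    have hF : (Finset.univ.filter fun b => F ≤ b) =
        insert F (Finset.univ.filter fun b => F < b) := by
      ext b; simp [le_iff_eq_or_lt, eq_comm]
    rw [hF, Finset.sum_insert (by simp), Finset.sum_insert (by simp), Nat.sub_self, pow_zero,
      one_mul]
    have h2 : (X - 1) * w F = (X - 1) + ∑ b with F < b,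
        (X ^ (grade ℕ b - grade ℕ F) - X) * w b := by
      conv_lhs => rw [hw F]
      rw [mul_add, mul_one, Finset.mul_sum]
      congr 1
      refine Finset.sum_congr rfl fun b hb => ?_
      have : grade ℕ F < grade ℕ b := grade_strictMono (Finset.mem_filter.1 hb).2
      rw [← mul_assoc, X_sub_one_mul_gapPoly (by omega)]
    simp only [sub_mul, Finset.sum_sub_distrib, ← Finset.mul_sum, one_mul] at h2
    linear_combination -h2
  have h2 : ∑ b with a ≤ b, charPoly a b * w b = X * w a := by
    have e1 : ∑ b with a ≤ b, charPoly a b * w b =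
        ∑ F with a ≤ F, C (moebius a F) * ∑ b with F ≤ b, X ^ (grade ℕ b - grade ℕ F) * w b := by
      simp only [charPoly, Finset.sum_mul, Finset.mul_sum, Finset.sum_filter]
      rw [Finset.sum_congr rfl fun b _ => ite_finsetSum .., Finset.sum_comm]
      refine Finset.sum_congr rfl fun F _ => ?_
      rw [ite_finsetSum]
      refine Finset.sum_congr rfl fun b _ => ?_
      by_cases h1 : a ≤ F <;> by_cases h2 : F ≤ b
      · simp [h1, h2, h1.trans h2, mul_assoc]
      all_goals simp [h1, h2]
    rw [e1]
    simp only [h1, mul_sub, Finset.sum_sub_distrib, ← Finset.sum_mul]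
    have e2 : ∑ F with a ≤ F, C (moebius a F) * (X * ∑ b with F ≤ b, w b) = X * w a := by
      have e3 : ∑ F with a ≤ F, C (moebius a F) * (X * ∑ b with F ≤ b, w b) =
          ∑ b with a ≤ b, C (∑ F with a ≤ F ∧ F ≤ b, moebius a F) * (X * w b) := by
        simp only [map_sum, Finset.sum_mul, Finset.mul_sum, Finset.sum_filter]
        rw [Finset.sum_congr rfl fun b _ => ite_finsetSum .., Finset.sum_comm]
        refine Finset.sum_congr rfl fun b _ => ?_
        rw [ite_finsetSum]
        refine Finset.sum_congr rfl fun F _ => ?_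
        by_cases h1 : a ≤ F <;> by_cases h2 : F ≤ b
        · simp [h1, h2, h1.trans h2]
        all_goals simp [h1, h2]
      rw [e3, Finset.sum_eq_single a]
      · rw [sum_moebius a a]; simp
      · intro b hb hne
        rw [sum_moebius a b, if_neg hne.symm]; simp
      · simp
    have e4 : ∑ F with a ≤ F, C (moebius a F) = 0 := by
      have := sum_moebius a ⊤
      rw [if_neg ha.ne] at this
      rw [← map_sum, ← map_zero C, ← this]
      simp
    rw [e2, e4]; ring
  have ha' : (Finset.univ.filter fun b => a ≤ b) =
      insert a (Finset.univ.filter fun b => a < b) := by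
    ext b; simp [le_iff_eq_or_lt, eq_comm]
  rw [ha', Finset.sum_insert (by simp), charPoly_self] at h2
  have h3 : (X - 1) * w a = (X - 1) * ∑ b with a < b, redCharPoly a b * w b := by
    rw [Finset.mul_sum, Finset.sum_congr rfl fun b hb => by
      rw [← mul_assoc, X_sub_one_mul_redCharPoly (Finset.mem_filter.1 hb).2]]
    linear_combination -h2
  exact mul_left_cancel₀ (by simpa using X_sub_C_ne_zero (1 : ℤ)) h3

end

variable [BoundedOrder P]

/-- The sum over all chains `a = c 0 < ⋯ < c k = ⊤` of the products of the values of `g` at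
consecutive elements. -/
def upperChainSum (g : P → P → ℤ[X]) (k : ℕ) (a : P) : ℤ[X] :=
  ∑ c : Fin (k + 1) → P with StrictMono c ∧ c 0 = a ∧ c (Fin.last k) = ⊤,
    ∏ i : Fin k, g (c i.castSucc) (c i.succ)

lemma upperChainSum_zero (g : P → P → ℤ[X]) (a : P) :
    upperChainSum g 0 a = if a = ⊤ then 1 else 0 := by
  unfold upperChainSum
  rw [Finset.sum_filter, Fintype.sum_equiv (Equiv.funUnique (Fin 1) P) _
    (fun p => if p = a ∧ p = ⊤ then 1 else 0)]
  · by_cases h : a = ⊤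
    · subst h; simp
    · rw [if_neg h]
      refine Finset.sum_eq_zero fun p _ => if_neg ?_
      rintro ⟨rfl, rfl⟩; exact h rfl
  · intro c
    simp [Fin.last, Subsingleton.strictMono]

lemma upperChainSum_succ (g : P → P → ℤ[X]) (k : ℕ) (a : P) :
    upperChainSum g (k + 1) a = ∑ b with a < b, g a b * upperChainSum g k b := by
  unfold upperChainSum
  have hcons : ∀ (q : P) (c : Fin (k + 1) → P),
      (StrictMono (Fin.cons q c : Fin (k + 2) → P) ∧ (Fin.cons q c : Fin (k + 2) → P) 0 = a ∧
        (Fin.cons q c : Fin (k + 2) → P) (Fin.last (k + 1)) = ⊤) ↔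
      q = a ∧ q < c 0 ∧ StrictMono c ∧ c (Fin.last k) = ⊤ := by
    intro q c
    rw [Fin.strictMono_iff_lt_succ, Fin.strictMono_iff_lt_succ, Fin.forall_fin_succ,
      ← Fin.succ_last]
    simp only [Fin.cons_zero, Fin.cons_succ, Fin.castSucc_zero, ← Fin.succ_castSucc]
    tauto
  rw [Finset.sum_filter, ← (Fin.consEquiv fun _ => P).sum_comp, Fintype.sum_prod_type,
    Finset.sum_comm]
  simp only [Finset.mul_sum, Finset.sum_filter]
  conv_rhs => rw [Finset.sum_congr rfl fun b _ => ite_finsetSum .., Finset.sum_comm]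
  refine Finset.sum_congr rfl fun c _ => ?_
  rw [Finset.sum_eq_single a, Finset.sum_eq_single (c 0)]
  · refine (if_congr (hcons a c) rfl rfl).trans ?_
    rw [Fin.prod_univ_succ]
    simp only [Fin.consEquiv, Equiv.coe_fn_mk, Fin.cons_zero, Fin.cons_succ, Fin.castSucc_zero, ← Fin.succ_castSucc, true_and]
    by_cases h : a < c 0 <;> simp [h]
  · intro b _ hb
    simp [hb.symm]
  · simp
  · intro q _ hq
    simp only [Fin.consEquiv, Equiv.coe_fn_mk, hcons]
    rw [if_neg (by tauto)]
  · simp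

variable [GradeMinOrder ℕ P]

theorem chowPolynomial_eq_of_recursion {w : P → ℤ[X]}
    (hw : ∀ a, w a = 1 + ∑ b with a < b, gapPoly (grade ℕ b - grade ℕ a) * w b)
    (hP : 0 < posetRank P) : chowPolynomial P = w ⊥ := by
  have key : ∀ N : ℕ, ∀ a : P, grade ℕ (⊤ : P) - grade ℕ a < N →
      ∑ k ∈ Finset.range N, upperChainSum redCharPoly k a = w a := by
    intro N
    induction N with
    | zero => intro a h; omega
    | succ N ih =>
      intro a ha
      rw [Finset.sum_range_succ', upperChainSum_zero]
      simp only [upperChainSum_succ]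
      rw [Finset.sum_comm]
      rcases eq_or_ne a ⊤ with rfl | hne
      · rw [hw]; simp
      · rw [if_neg hne, add_zero, eq_sum_redCharPoly_mul hw hne.lt_top]
        refine Finset.sum_congr rfl fun b hb => ?_
        have h1 : grade ℕ a < grade ℕ b := grade_strictMono (Finset.mem_filter.1 hb).2
        have h2 : grade ℕ b ≤ grade ℕ (⊤ : P) := grade_mono le_top
        rw [← Finset.mul_sum, ih b (by omega)]
  rw [chowPolynomial, if_neg hP.ne']
  exact key (posetRank P + 1) ⊥ (by unfold posetRank; omega)

end ChowPolynomial

/-! ### The lattice of flats -/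

section FlatLattice

variable {α : Type*} {M : Matroid α}

/-- The smallest flat containing the flat `F` and the element `e`. -/
def adjoin (F : Flats M) (e : α) : Flats M := ⟨M.closure (insert e F.1), M.isFlat_closure _⟩

lemma le_adjoin (F : Flats M) (e : α) : F ≤ adjoin F e := by
  have h := M.closure_subset_closure (Set.subset_insert e F.1)
  rwa [F.2.closure] at h

lemma mem_adjoin (F : Flats M) {e : α} (he : e ∈ M.E) : e ∈ (adjoin F e).1 :=
  M.mem_closure_of_mem' (Set.mem_insert _ _) he

lemma adjoin_le {F G : Flats M} {e : α} (hFG : F ≤ G) (he : e ∈ G.1) : adjoin F e ≤ G := by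
  have h := M.closure_subset_closure (Set.insert_subset he hFG)
  rwa [G.2.closure] at h

lemma exists_mem_notMem_of_lt {F G : Flats M} (h : F < G) : ∃ e ∈ G.1, e ∉ F.1 :=
  Set.not_subset.1 h.not_ge

lemma covBy_adjoin {F : Flats M} {e : α} (he : e ∈ M.E) (heF : e ∉ F.1) : F ⋖ adjoin F e := by
  refine ⟨lt_of_le_of_ne (le_adjoin F e) fun h => heF (h ▸ mem_adjoin F he), fun G hFG hG => ?_⟩
  obtain ⟨f, hfG, hfF⟩ := exists_mem_notMem_of_lt hFG
  have h : M.closure (insert f F.1) = M.closure (insert e F.1) :=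
    Matroid.closure_insert_congr ⟨hG.le hfG, by rwa [F.2.closure]⟩
  have h2 : adjoin F e ≤ G := by
    have := adjoin_le hFG.le hfG
    unfold adjoin at this ⊢
    simp only [h] at this
    exact this
  exact absurd h2 hG.not_ge

/-- The flats covering `F` partition the elements outside `F`. -/
lemma eq_adjoin_of_covBy {F G : Flats M} (h : F ⋖ G) {e : α} (he : e ∈ G.1) (heF : e ∉ F.1) :
    G = adjoin F e := by
  have h1 := adjoin_le h.le he
  have h2 : F < adjoin F e := (covBy_adjoin (G.2.subset_ground he) heF).lt
  exact (h1.eq_of_not_lt fun hlt => h.2 h2 hlt).symm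

lemma eRk_lt_of_lt {F G : Flats M} (h : F < G) : M.eRk F.1 + 1 ≤ M.eRk G.1 := by
  obtain ⟨e, heG, heF⟩ := exists_mem_notMem_of_lt h
  rw [← Matroid.eRk_insert_eq_add_one ⟨G.2.subset_ground heG, by rwa [F.2.closure]⟩]
  exact M.eRk_mono (Set.insert_subset heG h.le)

variable [M.Finite]

lemma eRk_ne_top (F : Flats M) : M.eRk F.1 ≠ ⊤ :=
  Matroid.eRk_ne_top_iff.2 (M.isRkFinite_set _)

/-- The lattice of flats is graded by the rank. -/
instance : GradeMinOrder ℕ (Flats M) where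
  grade F := (M.eRk F.1).toNat
  grade_strictMono F G h := by
    have h1 := eRk_lt_of_lt h
    have h2 := ENat.toNat_le_toNat h1 (eRk_ne_top G)
    rw [ENat.toNat_add (eRk_ne_top F) (by simp)] at h2
    exact h2
  covBy_grade F G h := by
    obtain ⟨e, heG, heF⟩ := exists_mem_notMem_of_lt h.lt
    rw [Order.covBy_iff_add_one_eq, eq_adjoin_of_covBy h heG heF]
    simp only [adjoin]
    rw [Matroid.eRk_closure_eq,
      Matroid.eRk_insert_eq_add_one ⟨G.2.subset_ground heG, by rwa [F.2.closure]⟩,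
      ENat.toNat_add (eRk_ne_top F) (by simp)]
    rfl
  isMin_grade F h := by
    have : F = ⊥ := h.eq_bot
    subst this
    have h0 : M.eRk (⊥ : Flats M).1 = 0 := M.eRk_loops
    rw [h0]
    exact isMin_bot

lemma grade_flat (F : Flats M) : grade ℕ F = (M.eRk F.1).toNat := rfl

lemma posetRank_flats {n : ℕ} (h : M.eRank = n) : posetRank (Flats M) = n := by
  have : M.eRk (⊤ : Flats M).1 = n := by
    rw [← h]; exact M.eRk_ground
  rw [posetRank, grade_flat, this]
  rfl

end FlatLattice

/-! ### The lattice of flats has an `R`-labeling -/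

section MinLabeling

variable {α : Type*} {M : Matroid α}

/-- The labeling of `F ⋖ G` by the smallest number `ν e` of an element `e ∈ G \ F`. -/
def minLabeling (ν : α → ℕ) (F G : Flats M) : ℕ := sInf (ν '' (G.1 \ F.1))

lemma exists_minLabeling_eq (ν : α → ℕ) {F G : Flats M} (h : F < G) :
    ∃ e ∈ G.1 \ F.1, minLabeling ν F G = ν e := by
  obtain ⟨e, heG, heF⟩ := exists_mem_notMem_of_lt h
  obtain ⟨x, hx, hx'⟩ := Nat.sInf_mem (s := ν '' (G.1 \ F.1)) ⟨_, e, ⟨heG, heF⟩, rfl⟩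
  exact ⟨x, hx, hx'.symm⟩

lemma minLabeling_le (ν : α → ℕ) {F G : Flats M} {e : α} (h : e ∈ G.1 \ F.1) :
    minLabeling ν F G ≤ ν e :=
  Nat.sInf_le ⟨e, h, rfl⟩

variable {ν : α → ℕ} {F G : Flats M} {k : ℕ} {c : Fin (k + 1) → Flats M}

/-- Every element of `G \ F` enters a maximal chain of `[F, G]` at some step. -/
lemma IsMaxChain.exists_labels_le (hc : IsMaxChain F G c) {e : α} (he : e ∈ G.1 \ F.1) :
    ∃ i, labels (minLabeling ν) c i ≤ ν e := by
  by_contra! hcon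
  have key : ∀ i, e ∉ (c i).1 := by
    intro i
    induction i using Fin.induction with
    | zero => rw [hc.1]; exact he.2
    | succ i ih => exact fun h => (minLabeling_le ν ⟨h, ih⟩).not_gt (hcon i)
  exact key (Fin.last k) (by rw [hc.2.1]; exact he.1)

lemma IsMaxChain.le_labels (hc : IsMaxChain F G c) {m : ℕ} (hm : ∀ e ∈ G.1 \ F.1, m ≤ ν e)
    (i : Fin k) : m ≤ labels (minLabeling ν) c i := by
  have hmono : Monotone c := Fin.monotone_iff_le_succ.2 fun i => (hc.2.2 i).le
  obtain ⟨e, he, he'⟩ := exists_minLabeling_eq ν (hc.2.2 i).lt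
  unfold labels
  rw [he']
  refine hm e ⟨?_, fun h => he.2 ?_⟩
  · rw [← hc.2.1]; exact hmono (Fin.le_last _) he.1
  · have := hmono (Fin.zero_le i.castSucc)
    rw [hc.1] at this
    exact this h

lemma incr_cons_eq {a : ℕ} {l : List ℕ} (h : ∀ x ∈ l, a ≤ x) :
    incr ℕ (a :: l) = incr ℕ l := by
  unfold incr
  simp only [List.isChain_iff_pairwise, List.pairwise_cons]
  simp only [and_iff_right (show ∀ x ∈ l, a ≤ x from h)]

lemma incr_cons_eq_zero {a x : ℕ} {l : List ℕ} (hx : x ∈ l) (h : x < a) :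
    incr ℕ (a :: l) = 0 := by
  unfold incr
  simp only [List.isChain_iff_pairwise, List.pairwise_cons]
  exact if_neg fun h' => (h'.1 x hx).not_gt h

/-- An increasing chain of `[F, G]` has to begin with the flat that adjoins to `F` the element of
`G \ F` with the smallest number. -/
theorem isRLabeling_minLabeling [M.Finite] (hν : Set.InjOn ν M.E) :
    IsRLabeling (minLabeling ν : Flats M → Flats M → ℕ) := by
  rw [isRLabeling_iff_chainSum]
  intro F G hFG
  obtain ⟨m, hm⟩ : ∃ m, m = grade ℕ G - grade ℕ F := ⟨_, rfl⟩
  rw [← hm]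
  induction m generalizing F with
  | zero =>
    have : F = G := hFG.eq_of_not_lt fun h => by
      have : grade ℕ F < grade ℕ G := grade_strictMono h
      omega
    rw [chainSum_zero, if_pos this]; simp [incr]
  | succ m ih =>
    have hlt : F < G := hFG.lt_of_ne fun h => by subst h; omega
    obtain ⟨e, he, hemin⟩ : ∃ e ∈ G.1 \ F.1, ∀ x ∈ G.1 \ F.1, ν e ≤ ν x := by
      obtain ⟨e, he, h⟩ := exists_minLabeling_eq ν hlt
      exact ⟨e, he, fun x hx => h ▸ minLabeling_le ν hx⟩
    have heE := G.2.subset_ground he.1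
    have hcov : F ⋖ adjoin F e := covBy_adjoin heE he.2
    have hle : adjoin F e ≤ G := adjoin_le hFG he.1
    have hgr : grade ℕ F + 1 = grade ℕ (adjoin F e) :=
      Order.covBy_iff_add_one_eq.1 (hcov.grade ℕ)
    rw [chainSum_succ, Finset.sum_eq_single (adjoin F e)]
    · rw [← ih _ hle (by omega)]
      refine chainSum_congr fun c hc => incr_cons_eq fun x hx => ?_
      obtain ⟨i, rfl⟩ := (List.mem_ofFn' _ _).1 hx
      refine (minLabeling_le ν ⟨mem_adjoin F heE, he.2⟩).trans (hc.le_labels ?_ i)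
      exact fun x hx => hemin x ⟨hx.1, fun h => hx.2 (le_adjoin F e h)⟩
    · intro p hp hpe
      have hFp : F ⋖ p := (Finset.mem_filter.1 hp).2
      by_cases hpG : p ≤ G
      · have hep : e ∉ p.1 := fun h => hpe (eq_adjoin_of_covBy hFp h he.2)
        obtain ⟨x, hx, hx'⟩ := exists_minLabeling_eq ν hFp.lt
        have hlt : ν e < minLabeling ν F p := by
          rw [hx']
          refine (hemin x ⟨hpG hx.1, hx.2⟩).lt_of_ne fun h => hep ?_
          rw [hν heE (p.2.subset_ground hx.1) h]; exact hx.1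
        refine Finset.sum_eq_zero fun c hc => ?_
        obtain ⟨i, hi⟩ := (Finset.mem_filter.1 hc).2.exists_labels_le (ν := ν) ⟨he.1, hep⟩
        exact incr_cons_eq_zero ((List.mem_ofFn' _ _).2 ⟨i, rfl⟩) (hi.trans_lt hlt)
      · exact chainSum_eq_zero_of_not_le hpG
    · exact fun h => absurd (Finset.mem_filter.2 ⟨Finset.mem_univ _, hcov⟩) h

lemma exists_isRLabeling [M.Finite] : ∃ lam : Flats M → Flats M → ℕ, IsRLabeling lam := by
  obtain ⟨ν, hν⟩ := Set.countable_iff_exists_injOn.1 M.ground_finite.countable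
  exact ⟨minLabeling ν, isRLabeling_minLabeling hν⟩

end MinLabeling

/-! ### The Feichtner–Yuzvinsky monomials -/

section FYMonomials

open Polynomial

variable {P : Type*} [PartialOrder P]

/-- `F` is the least element of the support of `f`. -/
def IsLeastIn (f : P →₀ ℕ) (F : P) : Prop := F ∈ f.support ∧ ∀ G ∈ f.support, F ≤ G

lemma IsLeastIn.unique {f : P →₀ ℕ} {F G : P} (hF : IsLeastIn f F) (hG : IsLeastIn f G) : F = G :=
  le_antisymm (hF.2 _ hG.1) (hG.2 _ hF.1)

lemma exists_isLeastIn {f : P →₀ ℕ} (h0 : f ≠ 0)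
    (h : ∀ F ∈ f.support, ∀ G ∈ f.support, F ≤ G ∨ G ≤ F) : ∃ F, IsLeastIn f F := by
  obtain ⟨F, hF⟩ := f.support.exists_minimal (Finsupp.support_nonempty_iff.2 h0)
  exact ⟨F, hF.1, fun G hG => (h F hF.1 G hG).elim id fun hGF => hF.2 hG hGF⟩

lemma isLeastIn_single_add {F : P} {i : ℕ} {f : P →₀ ℕ} (hi : 1 ≤ i)
    (h : ∀ G ∈ f.support, F < G) : IsLeastIn (Finsupp.single F i + f) F := by
  refine ⟨?_, fun G hG => ?_⟩
  · simp; omega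
  · by_contra hne
    have h1 : G ≠ F := fun h => hne h.ge
    have : G ∈ f.support := by
      rw [Finsupp.mem_support_iff, Finsupp.add_apply, Finsupp.single_eq_of_ne h1, zero_add] at hG
      exact Finsupp.mem_support_iff.2 hG
    exact hne (h G this).le

lemma erase_single_add {F : P} {i : ℕ} {f : P →₀ ℕ} (h : ∀ G ∈ f.support, F < G) :
    (Finsupp.single F i + f).erase F = f := by
  have hF : F ∉ f.support := fun hF => (h F hF).false
  rw [Finsupp.erase_add, Finsupp.erase_single, zero_add, Finsupp.erase_of_notMem_support hF]

lemma single_add_apply_self {F : P} {i : ℕ} {f : P →₀ ℕ} (h : ∀ G ∈ f.support, F < G) :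
    (Finsupp.single F i + f) F = i := by
  have hF : F ∉ f.support := fun hF => (h F hF).false
  rw [Finsupp.add_apply, Finsupp.single_eq_same, Finsupp.notMem_support_iff.1 hF, add_zero]

/-- A recursion along the strict upper sets has only one solution. -/
lemma eq_of_recursion [Fintype P] {w w' : P → ℤ[X]} {t : P → P → ℤ[X]}
    (hw : ∀ a, w a = 1 + ∑ b with a < b, t a b * w b)
    (hw' : ∀ a, w' a = 1 + ∑ b with a < b, t a b * w' b) (a : P) : w a = w' a := by
  induction a using WellFoundedGT.induction with
  | ind a ih =>
    rw [hw, hw']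
    congr 1
    refine Finset.sum_congr rfl fun b hb => ?_
    rw [ih b (Finset.mem_filter.1 hb).2]

variable [GradeOrder ℕ P]

/-- `IsFY a f` says that `∏ x_F ^ f F` is a Feichtner–Yuzvinsky monomial of the interval `[a, ⊤]`:
it is supported on a chain `a < F₁ < ⋯ < Fₖ`, and the exponent of `Fᵢ` is less than
`rank Fᵢ - rank Fᵢ₋₁`, where `F₀ = a`. (It is the same to ask that the exponent of `Fᵢ` be less than
`rank Fᵢ - rank Fⱼ` for all `j < i`.) -/
structure IsFY (a : P) (f : P →₀ ℕ) : Prop where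
  lt : ∀ F ∈ f.support, a < F
  chain : ∀ F ∈ f.support, ∀ G ∈ f.support, F ≤ G ∨ G ≤ F
  grade_base_add_lt : ∀ F ∈ f.support, grade ℕ a + f F < grade ℕ F
  grade_add_lt : ∀ F ∈ f.support, ∀ G ∈ f.support, G < F → grade ℕ G + f F < grade ℕ F

lemma IsFY.zero (a : P) : IsFY a (0 : P →₀ ℕ) := by constructor <;> simp

lemma IsFY.erase {a F : P} {f : P →₀ ℕ} (h : IsFY a f) (hF : IsLeastIn f F) :
    IsFY F (f.erase F) := by
  have hlt : ∀ G ∈ (f.erase F).support, F < G := by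
    intro G hG
    rw [Finsupp.support_erase, Finset.mem_erase] at hG
    exact (hF.2 G hG.2).lt_of_ne hG.1.symm
  have hmem : ∀ G ∈ (f.erase F).support, G ∈ f.support := fun G hG => by
    rw [Finsupp.support_erase, Finset.mem_erase] at hG; exact hG.2
  refine ⟨hlt, fun G hG H hH => h.chain G (hmem G hG) H (hmem H hH), fun G hG => ?_,
    fun G hG H hH hHG => ?_⟩
  · rw [Finsupp.erase_ne (hlt G hG).ne']
    exact h.grade_add_lt G (hmem G hG) F hF.1 (hlt G hG)
  · rw [Finsupp.erase_ne (hlt G hG).ne']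
    exact h.grade_add_lt G (hmem G hG) H (hmem H hH) hHG

lemma IsFY.single_add {a F : P} {i : ℕ} {f : P →₀ ℕ} (h : IsFY F f) (haF : a < F)
    (hi : grade ℕ a + i < grade ℕ F) : IsFY a (Finsupp.single F i + f) := by
  have hmem : ∀ G ∈ (Finsupp.single F i + f).support,
      G = F ∨ (G ∈ f.support ∧ (Finsupp.single F i + f) G = f G) := by
    intro G hG
    by_cases hGF : G = F
    · exact Or.inl hGF
    · have h1 : (Finsupp.single F i + f) G = f G := by
        rw [Finsupp.add_apply, Finsupp.single_eq_of_ne hGF, zero_add]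
      exact Or.inr ⟨by rw [Finsupp.mem_support_iff, h1] at hG; exact Finsupp.mem_support_iff.2 hG,
        h1⟩
  have hF := single_add_apply_self (i := i) h.lt
  refine ⟨fun G hG => ?_, fun G hG H hH => ?_, fun G hG => ?_, fun G hG H hH hHG => ?_⟩
  · rcases hmem G hG with rfl | ⟨hG', _⟩
    · exact haF
    · exact haF.trans (h.lt G hG')
  · rcases hmem G hG with rfl | ⟨hG', _⟩ <;> rcases hmem H hH with rfl | ⟨hH', _⟩
    · exact Or.inl le_rfl
    · exact Or.inl (h.lt H hH').le
    · exact Or.inr (h.lt G hG').le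
    · exact h.chain G hG' H hH'
  · rcases hmem G hG with rfl | ⟨hG', hG2⟩
    · rwa [hF]
    · rw [hG2]
      have := h.grade_base_add_lt G hG'
      have h2 : grade ℕ a < grade ℕ F := grade_strictMono haF
      omega
  · rcases hmem G hG with rfl | ⟨hG', hG2⟩
    · rcases hmem H hH with rfl | ⟨hH', _⟩
      · exact absurd hHG (lt_irrefl _)
      · exact absurd (h.lt H hH') hHG.not_gt
    · rw [hG2]
      rcases hmem H hH with rfl | ⟨hH', _⟩
      · exact h.grade_base_add_lt G hG'
      · exact h.grade_add_lt G hG' H hH' hHG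

variable [Fintype P]

lemma finite_setOf_isFY (a : P) : {f : P →₀ ℕ | IsFY a f}.Finite := by
  refine (Set.finite_Iic (Finsupp.equivFunOnFinite.symm fun F : P => grade ℕ F)).subset ?_
  intro f hf F
  rw [Finsupp.coe_equivFunOnFinite_symm]
  by_cases hF : F ∈ f.support
  · have := hf.grade_base_add_lt F hF
    omega
  · rw [Finsupp.notMem_support_iff.1 hF]; exact Nat.zero_le _

/-- The exponents of the Feichtner–Yuzvinsky monomials of `[a, ⊤]`. -/
def fySet (a : P) : Finset (P →₀ ℕ) := (finite_setOf_isFY a).toFinset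

lemma mem_fySet {a : P} {f : P →₀ ℕ} : f ∈ fySet a ↔ IsFY a f := by simp [fySet]

/-- The generating function of the Feichtner–Yuzvinsky monomials by degree. -/
def fyPoly (a : P) : ℤ[X] := ∑ f ∈ fySet a, X ^ f.degree

/-- Splitting off the power of `x_F`, for the smallest flat `F` of a monomial. -/
theorem fyPoly_eq (a : P) :
    fyPoly a = 1 + ∑ F with a < F, gapPoly (grade ℕ F - grade ℕ a) * fyPoly F := by
  have h0 : (0 : P →₀ ℕ) ∈ fySet a := mem_fySet.2 (IsFY.zero a)
  rw [fyPoly, ← Finset.add_sum_erase _ _ h0, map_zero, pow_zero]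
  congr 1
  have h1 : ∀ F : P, gapPoly (grade ℕ F - grade ℕ a) * fyPoly F =
      ∑ q ∈ Finset.Ico 1 (grade ℕ F - grade ℕ a) ×ˢ fySet F, X ^ (q.1 + q.2.degree) := by
    intro F
    rw [gapPoly, fyPoly, Finset.sum_mul_sum, Finset.sum_product]
    simp only [pow_add]
  rw [Finset.sum_congr rfl fun F _ => h1 F, Finset.sum_sigma', eq_comm]
  refine Finset.sum_nbij (fun s => Finsupp.single s.1 s.2.1 + s.2.2) ?_ ?_ ?_ ?_
  · rintro ⟨F, i, f⟩ h
    simp only [Finset.mem_sigma, Finset.mem_filter, Finset.mem_univ, true_and, Finset.mem_product,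
      Finset.mem_Ico, mem_fySet] at h
    obtain ⟨haF, ⟨hi1, hi2⟩, hf⟩ := h
    have hi : grade ℕ a + i < grade ℕ F := by omega
    refine Finset.mem_erase.2 ⟨fun h => ?_, mem_fySet.2 (hf.single_add haF hi)⟩
    have := single_add_apply_self (i := i) hf.lt
    simp only at h
    rw [h, Finsupp.zero_apply] at this
    omega
  · rintro ⟨F, i, f⟩ h ⟨G, j, g⟩ h' heq
    simp only [Finset.coe_sigma, Set.mem_sigma_iff, Finset.mem_coe, Finset.mem_filter,
      Finset.mem_univ, true_and, Finset.mem_product, Finset.mem_Ico, mem_fySet] at h h'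
    obtain ⟨_, ⟨hi, _⟩, hf⟩ := h
    obtain ⟨_, ⟨hj, _⟩, hg⟩ := h'
    simp only at heq
    have hF := isLeastIn_single_add hi hf.lt
    have hG := isLeastIn_single_add hj hg.lt
    rw [← heq] at hG
    obtain rfl := hF.unique hG
    have e1 := single_add_apply_self (i := i) hf.lt
    have e2 := erase_single_add (i := i) hf.lt
    rw [heq, single_add_apply_self hg.lt] at e1
    rw [heq, erase_single_add hg.lt] at e2
    rw [e1, e2]
  · intro f hf
    have hf0 := (Finset.mem_erase.1 hf).1
    have hf := mem_fySet.1 (Finset.mem_erase.1 hf).2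
    obtain ⟨F, hF⟩ := exists_isLeastIn hf0 hf.chain
    have h1 := hf.grade_base_add_lt F hF.1
    have h2 : f F ≠ 0 := Finsupp.mem_support_iff.1 hF.1
    refine ⟨⟨F, f F, f.erase F⟩, ?_, Finsupp.single_add_erase F f⟩
    simp only [Finset.coe_sigma, Set.mem_sigma_iff, Finset.mem_coe, Finset.mem_filter,
      Finset.mem_univ, true_and, Finset.mem_product, Finset.mem_Ico, mem_fySet]
    exact ⟨hf.lt F hF.1, ⟨by omega, by omega⟩, hf.erase hF⟩
  · rintro ⟨F, i, f⟩ _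
    simp

lemma coeff_fyPoly (a : P) (d : ℕ) :
    (fyPoly a).coeff d = ((fySet a).filter fun f => f.degree = d).card := by
  rw [fyPoly, finsetSum_coeff, Finset.card_filter, Nat.cast_sum]
  refine Finset.sum_congr rfl fun f _ => ?_
  rw [coeff_X_pow]
  simp [eq_comm]

end FYMonomials

/-! ### Degree maps -/

section DegreeMap

open MvPolynomial

variable {α : Type*} {M : Matroid α} [M.Finite]

/-- The sum of the variables `x_G` over the flats `G` strictly above `F`. -/
def sumAbove (F : Flats M) : MvPolynomial (Flats M) ℚ := ∑ G with F < G, X G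

/-- The linear form `∑ x_G` over the flats `G > a` containing `e`. -/
def linForm (a : Flats M) (e : α) : MvPolynomial (Flats M) ℚ := ∑ G with a < G ∧ e ∈ G.1, X G

/-- The coefficient `(-1) ^ (r - 1) * (k - 1).choose (r - 1)`, which arises from
`(y - β) ^ (k - 1)` by extracting the coefficient of the top power `y ^ (r - 1)`, up to the factor
`(-β) ^ (k - r)` and the degree `(-1) ^ (r - 1)` of `y ^ (r - 1)`. -/
def cutCoeff (r k : ℕ) : ℚ := (-1) ^ (r - 1) * ((k - 1).choose (r - 1) : ℚ)

/-- On monomials with smallest flat `F`, the degree on `[a, ⊤]` is the degree on `[F, ⊤]` after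
this map: the restriction to the divisor `x_F`, followed by the degree on `[a, F]`. On all other
monomials the map is zero. -/
def cutAt (a F : Flats M) : MvPolynomial (Flats M) ℚ →ₗ[ℚ] MvPolynomial (Flats M) ℚ :=
  (basisMonomials (Flats M) ℚ).constr ℚ fun f =>
    if IsLeastIn f F then cutCoeff (grade ℕ F - grade ℕ a) (f F) •
      ((-sumAbove F) ^ (f F - (grade ℕ F - grade ℕ a)) * monomial (f.erase F) 1) else 0

/-- The degree of the powers of `x_⊤`: `x_⊤ ^ k` has degree `(-1) ^ k` if `k + 1` is the rank of
`[a, ⊤]`, and `0` otherwise. On all other monomials the map is zero. -/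
def topDegree (a : Flats M) : MvPolynomial (Flats M) ℚ →ₗ[ℚ] ℚ :=
  (basisMonomials (Flats M) ℚ).constr ℚ fun f =>
    if f = Finsupp.single ⊤ (f ⊤) ∧ f ⊤ + 1 + grade ℕ a = grade ℕ (⊤ : Flats M)
      then (-1) ^ f ⊤ else 0

/-- The degree map of the Chow ring of the interval `[a, ⊤]`, as a linear functional on the
polynomial ring in the variables of all flats. It is defined by recursion on the smallest flat of a
monomial. -/
def degreeMap (a : Flats M) : MvPolynomial (Flats M) ℚ →ₗ[ℚ] ℚ :=
  topDegree a + ∑ F : {F : Flats M // a < F ∧ F < ⊤}, degreeMap F.1 ∘ₗ cutAt a F.1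
termination_by grade ℕ (⊤ : Flats M) - grade ℕ a
decreasing_by
  have h1 : grade ℕ a < grade ℕ F.1 := grade_strictMono F.2.1
  have h2 : grade ℕ F.1 < grade ℕ (⊤ : Flats M) := grade_strictMono F.2.2
  omega

lemma cutAt_monomial (a F : Flats M) (f : Flats M →₀ ℕ) : cutAt a F (monomial f 1) =
    if IsLeastIn f F then cutCoeff (grade ℕ F - grade ℕ a) (f F) •
      ((-sumAbove F) ^ (f F - (grade ℕ F - grade ℕ a)) * monomial (f.erase F) 1) else 0 := by
  rw [cutAt, show monomial f (1 : ℚ) = basisMonomials _ ℚ f by rw [coe_basisMonomials],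
    Module.Basis.constr_basis]

lemma topDegree_monomial (a : Flats M) (f : Flats M →₀ ℕ) : topDegree a (monomial f 1) =
    if f = Finsupp.single ⊤ (f ⊤) ∧ f ⊤ + 1 + grade ℕ a = grade ℕ (⊤ : Flats M)
      then (-1) ^ f ⊤ else 0 := by
  rw [topDegree, show monomial f (1 : ℚ) = basisMonomials _ ℚ f by rw [coe_basisMonomials],
    Module.Basis.constr_basis]

omit [M.Finite] in
lemma IsLeastIn.lt_top {f : Flats M →₀ ℕ} {F : Flats M} (hF : IsLeastIn f F)
    (hf : f ≠ Finsupp.single ⊤ (f ⊤)) : F < ⊤ := by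
  refine lt_top_iff_ne_top.2 fun h => hf ?_
  subst h
  ext G
  by_cases hG : G = ⊤
  · subst hG; simp
  · rw [Finsupp.single_eq_of_ne hG]
    by_contra hG'
    exact hG (top_le_iff.1 (hF.2 G (Finsupp.mem_support_iff.2 hG')))

lemma degreeMap_monomial_of_isLeastIn {a F : Flats M} {f : Flats M →₀ ℕ} (hF : IsLeastIn f F)
    (haF : a < F) (hFt : F < ⊤) : degreeMap a (monomial f 1) =
      cutCoeff (grade ℕ F - grade ℕ a) (f F) * degreeMap F
        ((-sumAbove F) ^ (f F - (grade ℕ F - grade ℕ a)) * monomial (f.erase F) 1) := by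
  rw [degreeMap, LinearMap.add_apply, LinearMap.sum_apply, topDegree_monomial, if_neg, zero_add,
    Finset.sum_eq_single (⟨F, haF, hFt⟩ : {F : Flats M // a < F ∧ F < ⊤})]
  · rw [LinearMap.comp_apply, cutAt_monomial, if_pos hF, map_smul, smul_eq_mul]
  · intro G _ hG
    rw [LinearMap.comp_apply, cutAt_monomial, if_neg, map_zero]
    exact fun h => hG (Subtype.ext (h.unique hF))
  · simp
  · rintro ⟨h, _⟩
    have := Finsupp.mem_support_iff.1 hF.1
    rw [h, Finsupp.single_eq_of_ne hFt.ne] at this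
    exact this rfl

lemma degreeMap_monomial_single_top (a : Flats M) (k : ℕ) :
    degreeMap a (monomial (Finsupp.single ⊤ k) 1) =
      if k + 1 + grade ℕ a = grade ℕ (⊤ : Flats M) then (-1) ^ k else 0 := by
  rw [degreeMap, LinearMap.add_apply, LinearMap.sum_apply, topDegree_monomial, Finset.sum_eq_zero,
    add_zero]
  · simp
  · intro F _
    rw [LinearMap.comp_apply, cutAt_monomial, if_neg, map_zero]
    intro h
    have := Finsupp.mem_support_iff.1 h.1
    rw [Finsupp.single_eq_of_ne F.2.2.ne] at this
    exact this rfl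

lemma degreeMap_monomial_eq_zero {a : Flats M} {f : Flats M →₀ ℕ}
    (hf : f ≠ Finsupp.single ⊤ (f ⊤)) (h : ∀ F, IsLeastIn f F → ¬ a < F) :
    degreeMap a (monomial f 1) = 0 := by
  rw [degreeMap, LinearMap.add_apply, LinearMap.sum_apply, topDegree_monomial, if_neg
    (fun h => hf h.1), zero_add]
  refine Finset.sum_eq_zero fun F _ => ?_
  rw [LinearMap.comp_apply, cutAt_monomial, if_neg (fun h' => h _ h' F.2.1), map_zero]

lemma linearMap_mul_eq_zero {σ : Type*} {L : MvPolynomial σ ℚ →ₗ[ℚ] ℚ} {q : MvPolynomial σ ℚ}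
    (h : ∀ f, L (monomial f 1 * q) = 0) (p : MvPolynomial σ ℚ) : L (p * q) = 0 := by
  have : L ∘ₗ LinearMap.mulRight ℚ q = 0 :=
    (basisMonomials σ ℚ).ext fun f => by simpa using h f
  simpa using LinearMap.congr_fun this p

/-- The degree map kills the products of incomparable flats. -/
lemma degreeMap_mul_of_incomparable {G H : Flats M} (h1 : ¬ G ≤ H) (h2 : ¬ H ≤ G) (a : Flats M)
    {g : Flats M →₀ ℕ} (hG : G ∈ g.support) (hH : H ∈ g.support)
    (p : MvPolynomial (Flats M) ℚ) : degreeMap a (p * monomial g 1) = 0 := by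
  induction a using WellFoundedGT.induction generalizing g p with
  | ind a ih =>
    refine linearMap_mul_eq_zero (fun f => ?_) p
    rw [monomial_mul, one_mul]
    have hG' : G ∈ (f + g).support := by
      rw [Finsupp.mem_support_iff] at hG ⊢; simp only [Finsupp.add_apply]; omega
    have hH' : H ∈ (f + g).support := by
      rw [Finsupp.mem_support_iff] at hH ⊢; simp only [Finsupp.add_apply]; omega
    generalize f + g = g' at hG' hH'
    have htop : g' ≠ Finsupp.single ⊤ (g' ⊤) := by
      intro h
      rw [h, Finsupp.mem_support_iff] at hG'
      refine hG' (Finsupp.single_eq_of_ne ?_)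
      rintro rfl; exact h2 le_top
    by_cases hF : ∃ F, IsLeastIn g' F ∧ a < F
    · obtain ⟨F, hF, haF⟩ := hF
      rw [degreeMap_monomial_of_isLeastIn hF haF (hF.lt_top htop), ih F haF, mul_zero]
      · rw [Finsupp.support_erase, Finset.mem_erase]
        refine ⟨?_, hG'⟩
        rintro rfl; exact h1 (hF.2 _ hH')
      · rw [Finsupp.support_erase, Finset.mem_erase]
        refine ⟨?_, hH'⟩
        rintro rfl; exact h2 (hF.2 _ hG')
    · push Not at hF
      exact degreeMap_monomial_eq_zero htop hF

/-- The degree map of `[a, ⊤]` kills the variables of the flats that are not above `a`. -/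
lemma degreeMap_mul_of_not_lt {a G : Flats M} (h : ¬ a < G) {g : Flats M →₀ ℕ}
    (hG : G ∈ g.support) (p : MvPolynomial (Flats M) ℚ) :
    degreeMap a (p * monomial g 1) = 0 := by
  refine linearMap_mul_eq_zero (fun f => ?_) p
  rw [monomial_mul, one_mul]
  have hG' : G ∈ (f + g).support := by
    rw [Finsupp.mem_support_iff] at hG ⊢; simp only [Finsupp.add_apply]; omega
  generalize f + g = g' at hG'
  by_cases htop : g' = Finsupp.single ⊤ (g' ⊤)
  · have hGt : G = ⊤ := by
      by_contra hne
      rw [htop, Finsupp.mem_support_iff] at hG'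
      exact hG' (Finsupp.single_eq_of_ne hne)
    have hat : a = ⊤ := by
      by_contra hne
      exact h (hGt ▸ lt_top_iff_ne_top.2 hne)
    rw [htop, degreeMap_monomial_single_top, hat, if_neg (by omega)]
  · exact degreeMap_monomial_eq_zero htop fun F hF haF => h (haF.trans_le (hF.2 G hG'))

lemma grade_adjoin {a : Flats M} {e : α} (he : e ∈ M.E) (hea : e ∉ a.1) :
    grade ℕ (adjoin a e) = grade ℕ a + 1 :=
  (Order.covBy_iff_add_one_eq.1 ((covBy_adjoin he hea).grade ℕ)).symm

lemma eq_adjoin_of_grade {a G : Flats M} {e : α} (haG : a < G) (he : e ∈ G.1) (hea : e ∉ a.1)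
    (h : grade ℕ G = grade ℕ a + 1) : G = adjoin a e := by
  refine ((adjoin_le haG.le he).eq_of_not_lt fun hlt => ?_).symm
  have h1 : grade ℕ (adjoin a e) < grade ℕ G := grade_strictMono hlt
  rw [grade_adjoin (G.2.subset_ground he) hea] at h1
  omega

/-- Multiplying by the variable of a flat smaller than all flats of a monomial. -/
lemma degreeMap_monomial_add_of_lt {a G : Flats M} {f : Flats M →₀ ℕ} (haG : a < G) (hGt : G < ⊤)
    (h : ∀ H ∈ f.support, G < H) : degreeMap a (monomial (f + Finsupp.single G 1) 1) =
      if grade ℕ G = grade ℕ a + 1 then degreeMap G (monomial f 1) else 0 := by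
  rw [add_comm, degreeMap_monomial_of_isLeastIn (isLeastIn_single_add le_rfl h) haG hGt,
    single_add_apply_self h, erase_single_add h, cutCoeff]
  have hg : grade ℕ a < grade ℕ G := grade_strictMono haG
  rw [show 1 - (grade ℕ G - grade ℕ a) = 0 by omega, pow_zero, one_mul]
  split_ifs with h1
  · rw [h1]; simp
  · rw [Nat.choose_eq_zero_of_lt (by omega)]; simp

lemma degreeMap_linForm_mul_single_top {a : Flats M} {e : α} (he : e ∈ M.E) (hea : e ∉ a.1)
    (k : ℕ) : degreeMap a (monomial (Finsupp.single ⊤ k) 1 * linForm a e) = 0 := by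
  have hval : ∀ G : Flats M, a < G ∧ e ∈ G.1 →
      degreeMap a (monomial (Finsupp.single ⊤ k) 1 * X G) =
      (if G = ⊤ then (if k + 2 + grade ℕ a = grade ℕ (⊤ : Flats M) then (-1) ^ (k + 1) else 0)
        else 0) + (if G = adjoin a e then
          (if k + 2 + grade ℕ a = grade ℕ (⊤ : Flats M) then (-1) ^ k else 0) else 0) := by
    rintro G ⟨haG, heG⟩
    rw [X, monomial_mul, one_mul]
    have hga := grade_adjoin he hea
    by_cases hG : G = ⊤
    · subst hG
      rw [← Finsupp.single_add, degreeMap_monomial_single_top, if_pos rfl, if_congr (show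
        k + 1 + 1 + grade ℕ a = grade ℕ (⊤ : Flats M) ↔ k + 2 + grade ℕ a = grade ℕ (⊤ : Flats M) by
          omega) rfl rfl, left_eq_add]
      split_ifs with h1 h2
      · rw [← h1] at hga; omega
      all_goals rfl
    · have hlt := lt_top_iff_ne_top.2 hG
      rw [degreeMap_monomial_add_of_lt haG hlt, degreeMap_monomial_single_top, if_neg hG, zero_add]
      · by_cases h1 : G = adjoin a e
        · rw [if_pos h1, if_pos (by rw [h1, hga]), h1, hga]
          exact if_congr (by omega) rfl rfl
        · rw [if_neg h1, if_neg fun h => h1 (eq_adjoin_of_grade haG heG hea h)]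
      · intro H hH
        have : H = ⊤ := by
          by_contra hne
          exact Finsupp.mem_support_iff.1 hH (Finsupp.single_eq_of_ne hne)
        rwa [this]
  have hat : a < ⊤ := lt_top_iff_ne_top.2 fun h => hea (h ▸ he)
  have hm1 : (⊤ : Flats M) ∈ Finset.univ.filter fun G : Flats M => a < G ∧ e ∈ G.1 :=
    Finset.mem_filter.2 ⟨Finset.mem_univ _, hat, he⟩
  have hm2 : adjoin a e ∈ Finset.univ.filter fun G : Flats M => a < G ∧ e ∈ G.1 :=
    Finset.mem_filter.2 ⟨Finset.mem_univ _, (covBy_adjoin he hea).lt, mem_adjoin a he⟩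
  rw [linForm, Finset.mul_sum, map_sum,
    Finset.sum_congr rfl fun G hG => hval G (Finset.mem_filter.1 hG).2, Finset.sum_add_distrib,
    Finset.sum_ite_eq', Finset.sum_ite_eq', if_pos hm1, if_pos hm2]
  split_ifs
  · ring
  · ring

lemma cutCoeff_pascal {r k : ℕ} (hr : 2 ≤ r) (hk : 1 ≤ k) :
    cutCoeff (r - 1) k + cutCoeff r (k + 1) - cutCoeff r k = 0 := by
  obtain ⟨s, rfl⟩ : ∃ s, r = s + 2 := ⟨r - 2, by omega⟩
  obtain ⟨j, rfl⟩ : ∃ j, k = j + 1 := ⟨k - 1, by omega⟩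
  simp only [cutCoeff, Nat.add_sub_cancel, show s + 2 - 1 = s + 1 by omega,
    Nat.choose_succ_succ' j s]
  push_cast
  ring

lemma cutCoeff_eq_zero {r k : ℕ} (hk : 1 ≤ k) (h : k < r) : cutCoeff r k = 0 := by
  rw [cutCoeff, Nat.choose_eq_zero_of_lt (by omega)]; simp

/-- The degree map of `[a, ⊤]` kills the linear relations. For a monomial with smallest flat `F` and
`e ∈ F`, only three kinds of flats `G ∋ e` matter: the cover of `a` that contains `e`, the flat `F`
itself, and the flats above `F`; their contributions cancel by Pascal's rule. -/
theorem degreeMap_mul_linForm {a : Flats M} {e : α} (he : e ∈ M.E) (hea : e ∉ a.1)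
    (p : MvPolynomial (Flats M) ℚ) : degreeMap a (p * linForm a e) = 0 := by
  induction a using WellFoundedGT.induction generalizing p with
  | ind a ih =>
  refine linearMap_mul_eq_zero (fun f => ?_) p
  by_cases htop : f = Finsupp.single ⊤ (f ⊤)
  · rw [htop]; exact degreeMap_linForm_mul_single_top he hea _
  have hf0 : f ≠ 0 := by
    rintro rfl; exact htop (by simp)
  have hcomm : ∀ G : Flats M, monomial f (1 : ℚ) * X G = X G * monomial f 1 := fun G => mul_comm _ _
  by_cases hchain : ∀ F ∈ f.support, ∀ G ∈ f.support, F ≤ G ∨ G ≤ F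
  swap
  · push Not at hchain
    obtain ⟨F, hF, G, hG, h1, h2⟩ := hchain
    rw [mul_comm]
    exact degreeMap_mul_of_incomparable h1 h2 a hF hG _
  obtain ⟨F, hF⟩ := exists_isLeastIn hf0 hchain
  by_cases haF : a < F
  swap
  · rw [mul_comm]; exact degreeMap_mul_of_not_lt haF hF.1 _
  have hFt := hF.lt_top htop
  obtain ⟨k, hk⟩ : ∃ k, k = f F := ⟨_, rfl⟩
  have hk1 : 1 ≤ k := by have := Finsupp.mem_support_iff.1 hF.1; omega
  have hgF : grade ℕ a < grade ℕ F := grade_strictMono haF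
  obtain ⟨r, hr⟩ : ∃ r, r = grade ℕ F - grade ℕ a := ⟨_, rfl⟩
  set f' := f.erase F with hf'
  -- the value at a flat above `F`
  have habove : ∀ G, F < G → degreeMap a (monomial f 1 * X G) =
      cutCoeff r k * degreeMap F ((-sumAbove F) ^ (k - r) * monomial f' 1 * X G) := by
    intro G hG
    rw [X, monomial_mul, one_mul, mul_assoc, monomial_mul, one_mul]
    have hL : IsLeastIn (f + Finsupp.single G 1) F := by
      refine ⟨by simp [Finsupp.mem_support_iff.1 hF.1], fun H hH => ?_⟩
      by_cases hHG : H = G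
      · exact hHG ▸ hG.le
      · refine hF.2 H ?_
        rwa [Finsupp.mem_support_iff, Finsupp.add_apply, Finsupp.single_eq_of_ne hHG, add_zero,
          ← Finsupp.mem_support_iff] at hH
    have hv : (f + Finsupp.single G 1 : Flats M →₀ ℕ) F = k := by
      rw [Finsupp.add_apply, Finsupp.single_eq_of_ne hG.ne, add_zero, hk]
    rw [degreeMap_monomial_of_isLeastIn hL haF hFt, hv, ← hr, Finsupp.erase_add,
      Finsupp.erase_single_ne hG.ne]
  have hincomp : ∀ G, ¬ F ≤ G → ¬ G ≤ F → degreeMap a (monomial f 1 * X G) = 0 := by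
    intro G h1 h2
    rw [X, monomial_mul, one_mul, ← one_mul (monomial _ _)]
    exact degreeMap_mul_of_incomparable h1 h2 a (by simp [Finsupp.mem_support_iff.1 hF.1])
      (by simp) 1
  rw [linForm, Finset.mul_sum, map_sum]
  by_cases heF : e ∈ F.1
  swap
  · -- only flats above `F` matter, and they form the relation of `e` on `[F, ⊤]`
    have hsum : ∑ G with a < G ∧ e ∈ G.1, degreeMap a (monomial f 1 * X G) =
        ∑ G with F < G ∧ e ∈ G.1,
          cutCoeff r k * degreeMap F ((-sumAbove F) ^ (k - r) * monomial f' 1 * X G) := by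
      simp only [Finset.sum_filter]
      refine Finset.sum_congr rfl fun G _ => ?_
      by_cases heG : e ∈ G.1
      · by_cases hFG : F < G
        · simp only [hFG, heG, haF.trans hFG, and_self, if_true, habove G hFG]
        · have hGF : ¬ G ≤ F := fun h => heF (h heG)
          have hFG' : ¬ F ≤ G := fun h => hFG (h.lt_of_ne fun h => hGF h.ge)
          simp [hFG, hincomp G hFG' hGF]
      · simp [heG]
    rw [hsum, ← Finset.mul_sum, ← map_sum, ← Finset.mul_sum, ← linForm, ih F haF heF, mul_zero]
  · set Y := degreeMap F ((-sumAbove F) ^ (k + 1 - r) * monomial f' 1) with hY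
    have hself : degreeMap a (monomial f 1 * X F) = cutCoeff r (k + 1) * Y := by
      rw [X, monomial_mul, one_mul]
      have hL : IsLeastIn (f + Finsupp.single F 1) F := by
        refine ⟨by simp, fun H hH => ?_⟩
        by_cases hHG : H = F
        · exact hHG.ge
        · refine hF.2 H ?_
          rwa [Finsupp.mem_support_iff, Finsupp.add_apply, Finsupp.single_eq_of_ne hHG, add_zero,
            ← Finsupp.mem_support_iff] at hH
      have hv : (f + Finsupp.single F 1 : Flats M →₀ ℕ) F = k + 1 := by
        rw [Finsupp.add_apply, Finsupp.single_eq_same, hk]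
      rw [degreeMap_monomial_of_isLeastIn hL haF hFt, hv, ← hr, Finsupp.erase_add,
        Finsupp.erase_single, add_zero]
    have hbelow : ∀ G, a < G → G < F → e ∈ G.1 → degreeMap a (monomial f 1 * X G) =
        if G = adjoin a e then cutCoeff (r - 1) k * Y else 0 := by
      intro G haG hGF heG
      rw [X, monomial_mul, one_mul, degreeMap_monomial_add_of_lt haG (hGF.trans hFt)
        fun H hH => hGF.trans_le (hF.2 H hH)]
      by_cases hG : G = adjoin a e
      · have hgr : grade ℕ G = grade ℕ a + 1 := by rw [hG, grade_adjoin he hea]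
        rw [if_pos hG, if_pos hgr, degreeMap_monomial_of_isLeastIn hF hGF hFt, ← hk, hgr, hY,
          show grade ℕ F - (grade ℕ a + 1) = r - 1 by omega,
          show k - (r - 1) = k + 1 - r by omega]
      · rw [if_neg hG, if_neg fun h => hG (eq_adjoin_of_grade haG heG hea h)]
    have hterm : ∀ G, (if a < G ∧ e ∈ G.1 then degreeMap a (monomial f 1 * X G) else 0) =
        (if G = adjoin a e then (if adjoin a e < F then cutCoeff (r - 1) k * Y else 0) else 0) +
        (if G = F then cutCoeff r (k + 1) * Y else 0) + (if F < G then
          cutCoeff r k * degreeMap F ((-sumAbove F) ^ (k - r) * monomial f' 1 * X G) else 0) := by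
      intro G
      have hadj : adjoin a e ≤ F := adjoin_le haF.le heF
      by_cases hGF : G < F
      · have h1 : G ≠ F := hGF.ne
        have h2 : ¬ F < G := hGF.not_gt
        by_cases hG : a < G ∧ e ∈ G.1
        · rw [if_pos hG, hbelow G hG.1 hGF hG.2, if_neg h1, if_neg h2, add_zero, add_zero]
          refine if_ctx_congr Iff.rfl (fun h => ?_) fun _ => rfl
          rw [if_pos (h ▸ hGF)]
        · have h3 : G ≠ adjoin a e := fun h =>
            hG ⟨h ▸ (covBy_adjoin he hea).lt, h ▸ mem_adjoin a he⟩
          simp [hG, h1, h2, h3]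
      · have h3 : (if G = adjoin a e then
            (if adjoin a e < F then cutCoeff (r - 1) k * Y else 0) else 0) = 0 := by
          split_ifs with h1 h2
          · exact absurd (h1 ▸ h2) hGF
          · rfl
          · rfl
        rw [h3, zero_add]
        by_cases hG : G = F
        · subst hG; simp [haF, heF, hself]
        · by_cases hFG : F < G
          · simp [hG, hFG, haF.trans hFG, hFG.le heF, habove G hFG]
          · have h1 : ¬ F ≤ G := fun h => hFG (h.lt_of_ne (Ne.symm hG))
            have h2 : ¬ G ≤ F := fun h => hGF (h.lt_of_ne hG)
            simp [hG, hFG, hincomp G h1 h2]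
    rw [Finset.sum_filter, Finset.sum_congr rfl fun G _ => hterm G, Finset.sum_add_distrib,
      Finset.sum_add_distrib, Finset.sum_ite_eq', Finset.sum_ite_eq', ← Finset.sum_filter,
      ← Finset.mul_sum, ← map_sum, ← Finset.mul_sum, ← sumAbove]
    simp only [Finset.mem_univ, if_true]
    -- the flats above `F` contribute a multiple of `Y` again
    have hlast : cutCoeff r k * degreeMap F
        ((-sumAbove F) ^ (k - r) * monomial f' 1 * sumAbove F) = -(cutCoeff r k * Y) := by
      by_cases hkr : k < r
      · rw [cutCoeff_eq_zero hk1 hkr]; ring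
      · rw [hY, show k + 1 - r = (k - r) + 1 by omega, pow_succ, ← mul_neg, ← map_neg]
        congr 2; ring
    rw [hlast]
    by_cases hlt : adjoin a e < F
    · have h1 : grade ℕ (adjoin a e) < grade ℕ F := grade_strictMono hlt
      rw [grade_adjoin he hea] at h1
      rw [if_pos hlt]
      linear_combination Y * cutCoeff_pascal (r := r) (by omega) hk1
    · have h1 : adjoin a e = F := (adjoin_le haF.le heF).eq_of_not_lt hlt
      have h2 : r = 1 := by rw [hr, ← h1, grade_adjoin he hea]; omega
      rw [if_neg hlt, h2]
      simp [cutCoeff]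

end DegreeMap

/-! ### Independence of the Feichtner–Yuzvinsky monomials -/

section Independence

open MvPolynomial

variable {α : Type*} {M : Matroid α} [M.Finite]

lemma degreeMap_monomial_single_add {a F : Flats M} (haF : a < F) (hFt : F < ⊤) {m : ℕ}
    (hm : 1 ≤ m) {f : Flats M →₀ ℕ} (hf : ∀ H ∈ f.support, F < H) :
    degreeMap a (monomial (Finsupp.single F m + f) 1) = cutCoeff (grade ℕ F - grade ℕ a) m *
      degreeMap F ((-sumAbove F) ^ (m - (grade ℕ F - grade ℕ a)) * monomial f 1) := by
  rw [degreeMap_monomial_of_isLeastIn (isLeastIn_single_add hm hf) haF hFt,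
    single_add_apply_self hf, erase_single_add hf]

lemma linearMap_mul_monomial {σ : Type*} (L : MvPolynomial σ ℚ →ₗ[ℚ] ℚ) (p : MvPolynomial σ ℚ)
    (g : σ →₀ ℕ) :
    L (p * monomial g 1) = ∑ f ∈ p.support, p.coeff f * L (monomial (f + g) 1) := by
  conv_lhs => rw [← support_sum_monomial_coeff p]
  rw [Finset.sum_mul, map_sum]
  refine Finset.sum_congr rfl fun f _ => ?_
  rw [monomial_mul, mul_one, ← smul_eq_mul, ← map_smul, smul_monomial, smul_eq_mul, mul_one]

lemma cutCoeff_self_ne_zero (r : ℕ) : cutCoeff r r ≠ 0 := by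
  simp [cutCoeff]

lemma mem_support_add {σ : Type*} {f g : σ →₀ ℕ} {H : σ} (h : H ∈ (f + g).support) :
    H ∈ f.support ∨ H ∈ g.support :=
  Finset.mem_union.1 (Finsupp.support_add h)

/-- The pairing of `p` with `x_F ^ (r - i) * x ^ g`, for `F` minimal among the smallest flats
of the monomials of `p` and `i` the highest exponent of `F` in those with smallest flat `F`: only
the monomials where this exponent is attained contribute. -/
lemma degreeMap_mul_monomial_of_isLeastIn {a F : Flats M} {p : MvPolynomial (Flats M) ℚ}
    (hp : ∀ f ∈ p.support, IsFY a f) (haF : a < F) (hFt : F < ⊤)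
    (hmin : ∀ f ∈ p.support, ∀ G, IsLeastIn f G → ¬ G < F) {i : ℕ} (hi : 1 ≤ i)
    (hir : grade ℕ a + i < grade ℕ F) (hmax : ∀ f ∈ p.support, IsLeastIn f F → f F ≤ i)
    {g : Flats M →₀ ℕ} (hg : ∀ H ∈ g.support, F < H) :
    degreeMap a (p * monomial (Finsupp.single F (grade ℕ F - grade ℕ a - i) + g) 1) =
      cutCoeff (grade ℕ F - grade ℕ a) (grade ℕ F - grade ℕ a) *
        ∑ f ∈ p.support with IsLeastIn f F ∧ f F = i,
          p.coeff f * degreeMap F (monomial (f.erase F + g) 1) := by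
  obtain ⟨r, hr⟩ : ∃ r, r = grade ℕ F - grade ℕ a := ⟨_, rfl⟩
  rw [← hr, linearMap_mul_monomial, Finset.sum_filter, Finset.mul_sum]
  refine Finset.sum_congr rfl fun f hf => ?_
  by_cases hL : IsLeastIn f F
  · have habove : ∀ H ∈ (f.erase F + g).support, F < H := by
      intro H hH
      rcases mem_support_add hH with h | h
      · exact ((hp f hf).erase hL).lt H h
      · exact hg H h
    have heq : f + (Finsupp.single F (r - i) + g) =
        Finsupp.single F (f F + (r - i)) + (f.erase F + g) := by
      conv_lhs => rw [← Finsupp.single_add_erase F f]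
      rw [Finsupp.single_add]; abel
    have hfF := hmax f hf hL
    have hfF0 := Finsupp.mem_support_iff.1 hL.1
    rw [heq, degreeMap_monomial_single_add haF hFt (by omega) habove, ← hr]
    by_cases hfi : f F = i
    · rw [if_pos ⟨hL, hfi⟩, show f F + (r - i) = r by omega, Nat.sub_self, pow_zero, one_mul]
      ring
    · rw [if_neg fun h => hfi h.2, cutCoeff_eq_zero (by omega) (by omega)]
      ring
  · rw [if_neg fun h => hL h.1, mul_zero]
    by_cases habove : ∀ H ∈ f.support, F < H
    · have habove' : ∀ H ∈ (f + g).support, F < H := fun H hH =>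
        (mem_support_add hH).elim (habove H) (hg H)
      rw [show f + (Finsupp.single F (r - i) + g) = Finsupp.single F (r - i) + (f + g) by abel,
        degreeMap_monomial_single_add haF hFt (by omega) habove', ← hr,
        cutCoeff_eq_zero (by omega) (by omega)]
      ring
    · have hf0 : f ≠ 0 := by rintro rfl; simp at habove
      obtain ⟨G, hG⟩ := exists_isLeastIn hf0 (hp f hf).chain
      have h1 : ¬ G ≤ F := fun h => by
        rcases h.eq_or_lt with rfl | h
        · exact hL hG
        · exact hmin f hf G hG h
      have h2 : ¬ F ≤ G := fun h => habove fun H hH =>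
        (h.lt_of_ne fun h => h1 h.ge).trans_le (hG.2 H hH)
      rw [← one_mul (monomial _ _), degreeMap_mul_of_incomparable h1 h2 a (g := _) _ _ 1, mul_zero]
      · have := Finsupp.mem_support_iff.1 hG.1
        rw [Finsupp.mem_support_iff]; simp only [Finsupp.add_apply]; omega
      · rw [Finsupp.mem_support_iff]
        simp only [Finsupp.add_apply, Finsupp.single_eq_same]; omega

/-- The degree pairing is nondegenerate on the span of the Feichtner–Yuzvinsky monomials. -/
theorem eq_zero_of_degreeMap_mul_eq_zero {a : Flats M} (ha : a < ⊤) {p : MvPolynomial (Flats M) ℚ}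
    (hp : ∀ f ∈ p.support, IsFY a f) (h : ∀ z, degreeMap a (p * z) = 0) : p = 0 := by
  induction a using WellFoundedGT.induction generalizing p with
  | ind a ih =>
  by_contra hp0
  by_cases hS : ∃ F, F < ⊤ ∧ ∃ f ∈ p.support, IsLeastIn f F
  · obtain ⟨F, ⟨hFt, f₁, hf₁, hf₁F⟩, hmin⟩ := wellFounded_lt.has_min
      {F : Flats M | F < ⊤ ∧ ∃ f ∈ p.support, IsLeastIn f F} hS
    obtain ⟨f₀, hf₀, hmax⟩ := Finset.exists_max_image
      (p.support.filter fun f => IsLeastIn f F) (fun f => f F) ⟨f₁, Finset.mem_filter.2 ⟨hf₁, hf₁F⟩⟩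
    obtain ⟨hf₀, hf₀F⟩ := Finset.mem_filter.1 hf₀
    have haF := (hp f₀ hf₀).lt F hf₀F.1
    set q := ∑ f ∈ p.support with IsLeastIn f F ∧ f F = f₀ F, monomial (f.erase F) (p.coeff f)
      with hq
    have hcoeff : ∀ f', q.coeff f' = ∑ f ∈ p.support with IsLeastIn f F ∧ f F = f₀ F,
        if f.erase F = f' then p.coeff f else 0 := by
      intro f'
      rw [hq, coeff_sum]
      exact Finset.sum_congr rfl fun f _ => coeff_monomial _ _ _
    have hq0 : q = 0 := by
      refine ih F haF hFt ?_ ?_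
      · intro f' hf'
        rw [mem_support_iff, hcoeff] at hf'
        obtain ⟨f, hf, hne⟩ := Finset.exists_ne_zero_of_sum_ne_zero hf'
        obtain ⟨hf, hfF, _⟩ := Finset.mem_filter.1 hf
        have : f.erase F = f' := by by_contra h; simp [h] at hne
        exact this ▸ (hp f hf).erase hfF
      · intro z
        rw [mul_comm]
        refine linearMap_mul_eq_zero (fun g => ?_) z
        by_cases hg : ∀ H ∈ g.support, F < H
        · have h1 := degreeMap_mul_monomial_of_isLeastIn hp haF hFt
            (fun f hf G hG hGF => hmin G ⟨hGF.trans hFt, f, hf, hG⟩ hGF)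
            (Nat.one_le_iff_ne_zero.2 (Finsupp.mem_support_iff.1 hf₀F.1))
            ((hp f₀ hf₀).grade_base_add_lt F hf₀F.1)
            (fun f hf hfF => hmax f (Finset.mem_filter.2 ⟨hf, hfF⟩)) hg
          rw [h, zero_eq_mul, or_iff_right (cutCoeff_self_ne_zero _)] at h1
          rw [← h1, hq, Finset.mul_sum, map_sum]
          refine Finset.sum_congr rfl fun f _ => ?_
          rw [monomial_mul, one_mul, add_comm, ← smul_eq_mul, ← map_smul, smul_monomial,
            smul_eq_mul, mul_one]
        · push Not at hg
          obtain ⟨H, hH, hFH⟩ := hg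
          rw [mul_comm]
          exact degreeMap_mul_of_not_lt hFH hH q
    have h2 := hcoeff (f₀.erase F)
    rw [hq0, coeff_zero, Finset.sum_eq_single f₀, if_pos rfl] at h2
    · exact mem_support_iff.1 hf₀ h2.symm
    · intro f hf hne
      obtain ⟨_, _, hfi⟩ := Finset.mem_filter.1 hf
      refine if_neg fun he => hne ?_
      rw [← Finsupp.single_add_erase F f, he, hfi, Finsupp.single_add_erase]
    · exact fun h => absurd (Finset.mem_filter.2 ⟨hf₀, hf₀F, rfl⟩) h
  · -- only powers of `x_⊤` are left
    have hsingle : ∀ f ∈ p.support, f = Finsupp.single ⊤ (f ⊤) := by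
      intro f hf
      by_contra hne
      have hf0 : f ≠ 0 := by rintro rfl; simp at hne
      obtain ⟨F, hF⟩ := exists_isLeastIn hf0 (hp f hf).chain
      exact hS ⟨F, hF.lt_top hne, f, hf, hF⟩
    obtain ⟨f₀, hf₀⟩ := support_nonempty.2 hp0
    have hg : grade ℕ a < grade ℕ (⊤ : Flats M) := grade_strictMono ha
    have hbound : grade ℕ a + f₀ ⊤ < grade ℕ (⊤ : Flats M) := by
      by_cases hmem : ⊤ ∈ f₀.support
      · exact (hp f₀ hf₀).grade_base_add_lt ⊤ hmem
      · rwa [Finsupp.notMem_support_iff.1 hmem, add_zero]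
    obtain ⟨s, hs⟩ : ∃ s, grade ℕ a + f₀ ⊤ + s + 1 = grade ℕ (⊤ : Flats M) :=
      ⟨grade ℕ (⊤ : Flats M) - (grade ℕ a + f₀ ⊤ + 1), by omega⟩
    have h1 := h (monomial (Finsupp.single ⊤ s) 1)
    rw [linearMap_mul_monomial, Finset.sum_eq_single f₀] at h1
    · rw [hsingle f₀ hf₀, ← Finsupp.single_add, degreeMap_monomial_single_top, if_pos (by omega),
        ← hsingle f₀ hf₀] at h1
      exact mem_support_iff.1 hf₀ (by simpa using h1)
    · intro f hf hne
      rw [hsingle f hf, ← Finsupp.single_add, degreeMap_monomial_single_top, if_neg, mul_zero]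
      intro h2
      refine hne ?_
      rw [hsingle f hf, hsingle f₀ hf₀, show f ⊤ = f₀ ⊤ by omega]
    · exact fun h => absurd hf₀ h

end Independence

/-! ### The Feichtner–Yuzvinsky monomials span -/

section Spanning

variable {α : Type*} {M : Matroid α} [M.Finite] {A : Type*} [CommRing A] [Algebra ℚ A]

/-- A family of elements, indexed by the flats, that satisfies the relations of the Chow ring. The
smallest flat, which is not a generator of the Chow ring, has the value `1`. -/
structure IsChowFamily (x : Flats M → A) : Prop where
  bot : x ⊥ = 1
  mul_eq_zero : ∀ F G, ¬ F ≤ G → ¬ G ≤ F → x F * x G = 0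
  sum_eq_zero : ∀ e ∈ M.E, ∑ F with e ∈ F.1, x F = 0

/-- The sum of `x_H` over all flats `H ≥ G`. -/
def upperSum (x : Flats M → A) (G : Flats M) : A := ∑ H with G ≤ H, x H

variable {x : Flats M → A}

omit [Algebra ℚ A] in
/-- On the multiples of `x_H`, the sum over the flats above `G` can be replaced by the sum over the
flats above the join `G'` of `G` and `H`. -/
lemma IsChowFamily.mul_upperSum_pow_eq (hx : IsChowFamily x) {G G' H : Flats M} (hGH : ¬ G ≤ H)
    (hG' : ∀ K, G' ≤ K ↔ G ≤ K ∧ H ≤ K) (d : ℕ) :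
    x H * upperSum x G ^ d = x H * upperSum x G' ^ d := by
  have h1 : x H * upperSum x G = x H * upperSum x G' := by
    simp only [upperSum, Finset.mul_sum, Finset.sum_filter]
    refine Finset.sum_congr rfl fun K _ => ?_
    by_cases hGK : G ≤ K
    · by_cases hHK : H ≤ K
      · simp [hG', hGK, hHK]
      · have : ¬ K ≤ H := fun h => hGH (hGK.trans h)
        simp [hG', hGK, hHK, hx.mul_eq_zero H K hHK this]
    · simp [hG', hGK]
  induction d with
  | zero => simp
  | succ d ih => rw [pow_succ, ← mul_assoc, ih, mul_right_comm, h1, mul_right_comm, pow_succ,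
      mul_assoc]

omit [Algebra ℚ A] in
/-- If `G` is the flat spanned by `a` and `d` further elements, then `x_a * h_G ^ d = 0`, where
`h_G` is the sum of the `x_H` with `H ≥ G`. One factor `h_G` is rewritten with the linear relation
of one of these elements. -/
lemma IsChowFamily.mul_upperSum_pow_eq_zero (hx : IsChowFamily x) {a G : Flats M} (haG : a < G)
    {S : Finset α} (hS : ∀ H, a ≤ H → (G ≤ H ↔ ↑S ⊆ H.1)) :
    x a * upperSum x G ^ S.card = 0 := by
  obtain ⟨d, hd⟩ : ∃ d, S.card = d := ⟨_, rfl⟩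
  induction d generalizing a G S with
  | zero =>
    rw [Finset.card_eq_zero] at hd
    exact absurd ((hS a le_rfl).2 (by simp [hd])) haG.not_ge
  | succ d ih =>
    obtain ⟨e, heS, hea⟩ : ∃ e ∈ S, e ∉ a.1 := by
      by_contra! hcon
      exact haG.not_ge ((hS a le_rfl).2 hcon)
    have hSG : ↑S ⊆ G.1 := (hS G haG.le).1 le_rfl
    have heE : e ∈ M.E := G.2.subset_ground (hSG heS)
    have h1 : x a * upperSum x G = -∑ H with a < H ∧ e ∈ H.1 ∧ ¬ G ≤ H, x a * x H := by
      rw [eq_neg_iff_add_eq_zero, ← mul_zero (x a), ← hx.sum_eq_zero e heE]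
      simp only [upperSum, Finset.mul_sum, Finset.sum_filter]
      rw [← Finset.sum_add_distrib]
      refine Finset.sum_congr rfl fun H _ => ?_
      by_cases hGH : G ≤ H
      · have : e ∈ H.1 := hGH (hSG heS)
        simp [hGH, this]
      · by_cases heH : e ∈ H.1
        · by_cases haH : a < H
          · simp [hGH, heH, haH]
          · have h2 : ¬ H ≤ a := fun h => hea (h heH)
            have h3 : ¬ a ≤ H := fun h => haH (h.lt_of_ne fun h => h2 h.ge)
            simp [hGH, heH, haH, hx.mul_eq_zero a H h3 h2]
        · simp [hGH, heH]
    rw [hd, pow_succ', ← mul_assoc, h1, neg_mul, Finset.sum_mul, neg_eq_zero]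
    refine Finset.sum_eq_zero fun H hH => ?_
    obtain ⟨_, haH, heH, hGH⟩ := Finset.mem_filter.1 hH
    -- the join of `G` and `H` is spanned by `H` and one element less
    set G' : Flats M := ⟨M.closure (H.1 ∪ ↑S), M.isFlat_closure _⟩ with hG'
    have hHE : H.1 ∪ ↑S ⊆ M.E :=
      Set.union_subset H.2.subset_ground (hSG.trans G.2.subset_ground)
    have hG'le : ∀ K : Flats M, G' ≤ K ↔ G ≤ K ∧ H ≤ K := by
      intro K
      constructor
      · intro h
        have h2 : H.1 ∪ ↑S ⊆ K.1 := (M.subset_closure _ hHE).trans h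
        have h3 : H ≤ K := Set.subset_union_left.trans h2
        exact ⟨(hS K (haH.le.trans h3)).2 (Set.subset_union_right.trans h2), h3⟩
      · rintro ⟨h2, h3⟩
        have h4 : H.1 ∪ ↑S ⊆ K.1 := Set.union_subset h3 ((hS K (haH.le.trans h3)).1 h2)
        have := M.closure_subset_closure h4
        rwa [K.2.closure] at this
    have hHG' : H < G' := by
      refine lt_of_le_of_ne ((hG'le G').1 le_rfl).2 fun h => hGH ?_
      rw [h]; exact ((hG'le G').1 le_rfl).1
    have hS' : ∀ K, H ≤ K → (G' ≤ K ↔ ↑(S.erase e) ⊆ K.1) := by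
      intro K hHK
      rw [hG'le, and_iff_left hHK, hS K (haH.le.trans hHK), Finset.coe_erase,
        Set.sdiff_singleton_subset_iff, Set.insert_eq_of_mem (hHK heH)]
    have hcard : (S.erase e).card = d := by rw [Finset.card_erase_of_mem heS, hd]; rfl
    have h0 := ih hHG' hS' hcard
    rw [mul_assoc, hx.mul_upperSum_pow_eq hGH hG'le, ← hcard, h0, mul_zero]

lemma exists_spanning_finset {a G : Flats M} (haG : a ≤ G) :
    ∃ S : Finset α, S.card ≤ grade ℕ G - grade ℕ a ∧ ∀ H, a ≤ H → (G ≤ H ↔ ↑S ⊆ H.1) := by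
  obtain ⟨d, hd⟩ : ∃ d, grade ℕ G - grade ℕ a = d := ⟨_, rfl⟩
  rw [hd]
  induction d generalizing a with
  | zero =>
    have : a = G := haG.eq_of_not_lt fun h => by
      have : grade ℕ a < grade ℕ G := grade_strictMono h
      omega
    subst this
    exact ⟨∅, le_rfl, fun H haH => by simpa using haH⟩
  | succ d ih =>
    have hlt : a < G := haG.lt_of_ne fun h => by subst h; omega
    obtain ⟨e, heG, hea⟩ := exists_mem_notMem_of_lt hlt
    have heE := G.2.subset_ground heG
    obtain ⟨S, hS, hS'⟩ := ih (adjoin_le haG heG) (by rw [grade_adjoin heE hea]; omega)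
    refine ⟨insert e S, (Finset.card_insert_le _ _).trans (by omega), fun H haH => ?_⟩
    rw [Finset.coe_insert, Set.insert_subset_iff]
    constructor
    · intro h
      exact ⟨h heG, (hS' H (adjoin_le haH (h heG))).1 h⟩
    · rintro ⟨h1, h2⟩
      exact (hS' H (adjoin_le haH h1)).2 h2

omit [Algebra ℚ A] in
lemma IsChowFamily.mul_upperSum_pow_grade (hx : IsChowFamily x) {a G : Flats M} (haG : a < G)
    {r : ℕ} (hr : grade ℕ G ≤ grade ℕ a + r) : x a * upperSum x G ^ r = 0 := by
  obtain ⟨S, hS, hS'⟩ := exists_spanning_finset haG.le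
  obtain ⟨s, rfl⟩ := Nat.exists_eq_add_of_le (show S.card ≤ r by omega)
  rw [pow_add, ← mul_assoc, hx.mul_upperSum_pow_eq_zero haG hS', zero_mul]

/-- The value of the monomial with exponents `f`. -/
def monomialValue (x : Flats M → A) (f : Flats M →₀ ℕ) : A := f.prod fun F k => x F ^ k

omit [M.Finite] [Algebra ℚ A] in
lemma monomialValue_add (f g : Flats M →₀ ℕ) :
    monomialValue x (f + g) = monomialValue x f * monomialValue x g :=
  Finsupp.prod_add_index' (fun _ => pow_zero _) fun _ _ _ => pow_add _ _ _

omit [M.Finite] [Algebra ℚ A] in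
lemma monomialValue_single (F : Flats M) (k : ℕ) :
    monomialValue x (Finsupp.single F k) = x F ^ k :=
  Finsupp.prod_single_index (pow_zero _)

/-- The sum of the ranks of the flats of a monomial, with multiplicity. -/
def gradeWeight : (Flats M →₀ ℕ) →+ ℕ :=
  Finsupp.liftAddHom fun F => AddMonoidHom.mulRight (grade ℕ F)

lemma gradeWeight_single (F : Flats M) (k : ℕ) :
    gradeWeight (Finsupp.single F k) = k * grade ℕ F := by
  simp [gradeWeight]

lemma gradeWeight_le (f : Flats M →₀ ℕ) :
    gradeWeight f ≤ f.degree * grade ℕ (⊤ : Flats M) := by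
  induction f using Finsupp.induction_linear with
  | zero => simp
  | add f g hf hg => rw [map_add, map_add, add_mul]; exact add_le_add hf hg
  | single F k =>
    rw [gradeWeight_single, Finsupp.degree_single]
    exact Nat.mul_le_mul_left _ (grade_mono le_top)

/-- The span of the monomials of degree `d` and weight at least `w` in the flats other than `⊥`. -/
def weightSpan (x : Flats M → A) (d w : ℕ) : Submodule ℚ A :=
  Submodule.span ℚ (monomialValue x '' {f | ⊥ ∉ f.support ∧ f.degree = d ∧ w ≤ gradeWeight f})

lemma monomialValue_mem_weightSpan {f : Flats M →₀ ℕ} {w : ℕ} (hf : ⊥ ∉ f.support)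
    (hw : w ≤ gradeWeight f) : monomialValue x f ∈ weightSpan x f.degree w :=
  Submodule.subset_span ⟨f, ⟨hf, rfl, hw⟩, rfl⟩

lemma mul_mem_weightSpan {d d' w w' : ℕ} {y z : A} (hy : y ∈ weightSpan x d w)
    (hz : z ∈ weightSpan x d' w') : y * z ∈ weightSpan x (d + d') (w + w') := by
  have h := Submodule.mul_mem_mul hy hz
  rw [weightSpan, weightSpan, Submodule.span_mul_span] at h
  refine Submodule.span_mono ?_ h
  rintro _ ⟨_, ⟨f, ⟨hf, hfd, hfw⟩, rfl⟩, _, ⟨g, ⟨hg, hgd, hgw⟩, rfl⟩, rfl⟩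
  refine ⟨f + g, ⟨fun h => ?_, ?_, ?_⟩, monomialValue_add f g⟩
  · exact (mem_support_add h).elim hf hg
  · rw [map_add, hfd, hgd]
  · rw [map_add]; exact add_le_add hfw hgw

lemma mem_weightSpan_one {F : Flats M} (hF : ⊥ < F) {w : ℕ} (hw : w ≤ grade ℕ F) :
    x F ∈ weightSpan x 1 w := by
  have h := monomialValue_mem_weightSpan (x := x) (f := Finsupp.single F 1) (w := w)
    (by simp [hF.ne]) (by rwa [gradeWeight_single, one_mul])
  rwa [monomialValue_single, pow_one, Finsupp.degree_single] at h

lemma upperSum_sub_mem {F : Flats M} (hF : ⊥ < F) :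
    upperSum x F - x F ∈ weightSpan x 1 (grade ℕ F + 1) := by
  have h1 : (Finset.univ.filter fun H => F ≤ H) =
      insert F (Finset.univ.filter fun H => F < H) := by
    ext b; simp [le_iff_eq_or_lt, eq_comm]
  rw [upperSum, h1, Finset.sum_insert (by simp), add_sub_cancel_left]
  refine Submodule.sum_mem _ fun H hH => ?_
  have hFH := (Finset.mem_filter.1 hH).2
  have h2 : grade ℕ F < grade ℕ H := grade_strictMono hFH
  exact mem_weightSpan_one (hF.trans hFH) h2

lemma pow_mem_weightSpan {F : Flats M} (hF : ⊥ < F) (r : ℕ) :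
    x F ^ r ∈ weightSpan x r (r * grade ℕ F) := by
  have h := monomialValue_mem_weightSpan (x := x) (f := Finsupp.single F r) (w := r * grade ℕ F)
    (by rw [Finsupp.mem_support_iff, Finsupp.single_eq_of_ne hF.ne]; simp)
    (gradeWeight_single F r).ge
  rwa [monomialValue_single, Finsupp.degree_single] at h

lemma weightSpan_mono (d : ℕ) {w w' : ℕ} (h : w ≤ w') : weightSpan x d w' ≤ weightSpan x d w :=
  Submodule.span_mono (Set.image_mono fun _ hf => ⟨hf.1, hf.2.1, h.trans hf.2.2⟩)

lemma upperSum_pow_sub_pow_mem {F : Flats M} (hF : ⊥ < F) (r : ℕ) :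
    upperSum x F ^ r - x F ^ r ∈ weightSpan x r (r * grade ℕ F + 1) := by
  have hsum : upperSum x F ∈ weightSpan x 1 (grade ℕ F) := by
    have := Submodule.add_mem _ (weightSpan_mono 1 (Nat.le_succ _) (upperSum_sub_mem (x := x) hF))
      (mem_weightSpan_one hF le_rfl)
    rwa [sub_add_cancel] at this
  induction r with
  | zero => simp
  | succ r ih =>
    have h1 := mul_mem_weightSpan ih hsum
    have h2 := mul_mem_weightSpan (pow_mem_weightSpan (x := x) hF r) (upperSum_sub_mem hF)
    rw [show r * grade ℕ F + 1 + grade ℕ F = (r + 1) * grade ℕ F + 1 by ring] at h1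
    rw [show r * grade ℕ F + (grade ℕ F + 1) = (r + 1) * grade ℕ F + 1 by ring] at h2
    convert Submodule.add_mem _ h1 h2 using 1
    ring

omit [Algebra ℚ A] in
/-- A monomial that is supported on a chain and is not a Feichtner–Yuzvinsky monomial is divisible
by `x_a * x_F ^ r` for some `a < F` with `rank F ≤ rank a + r`. -/
lemma exists_of_not_isFY (hx : IsChowFamily x) {f : Flats M →₀ ℕ} (hbot : ⊥ ∉ f.support)
    (hchain : ∀ F ∈ f.support, ∀ G ∈ f.support, F ≤ G ∨ G ≤ F) (hf : ¬ IsFY ⊥ f) :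
    ∃ a F r g c, a < F ∧ grade ℕ F ≤ grade ℕ a + r ∧ f = Finsupp.single F r + g ∧
      monomialValue x g = c * x a := by
  have hsub : ∀ F : Flats M, ∀ r ≤ f F, f = Finsupp.single F r + (f - Finsupp.single F r) := by
    intro F r hr
    rw [add_tsub_cancel_of_le]
    exact Finsupp.single_le_iff.2 hr
  by_cases h1 : ∀ F ∈ f.support, grade ℕ (⊥ : Flats M) + f F < grade ℕ F
  · by_cases h2 : ∀ F ∈ f.support, ∀ G ∈ f.support, G < F → grade ℕ G + f F < grade ℕ F
    · exact absurd ⟨fun F hF => bot_lt_iff_ne_bot.2 fun h => hbot (h ▸ hF), hchain, h1, h2⟩ hf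
    · push Not at h2
      obtain ⟨F, hF, G, hG, hGF, hle⟩ := h2
      refine ⟨G, F, f F, f - Finsupp.single F (f F),
        monomialValue x (f - Finsupp.single F (f F) - Finsupp.single G 1), hGF, hle,
        hsub F _ le_rfl, ?_⟩
      have h3 : Finsupp.single G 1 ≤ f - Finsupp.single F (f F) := by
        rw [Finsupp.single_le_iff, Finsupp.tsub_apply, Finsupp.single_eq_of_ne hGF.ne]
        have := Finsupp.mem_support_iff.1 hG
        omega
      conv_lhs => rw [← tsub_add_cancel_of_le h3]
      rw [monomialValue_add, monomialValue_single, pow_one]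
  · push Not at h1
    obtain ⟨F, hF, hle⟩ := h1
    exact ⟨⊥, F, f F, f - Finsupp.single F (f F), monomialValue x (f - Finsupp.single F (f F)),
      bot_lt_iff_ne_bot.2 fun h => hbot (h ▸ hF), hle, hsub F _ le_rfl, by rw [hx.bot, mul_one]⟩

/-- Every monomial is a combination of Feichtner–Yuzvinsky monomials of the same degree: the
relation `x_a * h_F ^ r = 0` expresses any other monomial by monomials of higher weight. -/
theorem IsChowFamily.monomialValue_mem_span (hx : IsChowFamily x) {f : Flats M →₀ ℕ}
    (hbot : ⊥ ∉ f.support) :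
    monomialValue x f ∈
      Submodule.span ℚ (monomialValue x '' {g | IsFY ⊥ g ∧ g.degree = f.degree}) := by
  obtain ⟨N, hN⟩ : ∃ N, f.degree * grade ℕ (⊤ : Flats M) - gradeWeight f = N := ⟨_, rfl⟩
  induction N using Nat.strong_induction_on generalizing f with
  | _ N ih =>
  by_cases hf : IsFY ⊥ f
  · exact Submodule.subset_span ⟨f, ⟨hf, rfl⟩, rfl⟩
  by_cases hchain : ∀ F ∈ f.support, ∀ G ∈ f.support, F ≤ G ∨ G ≤ F
  swap
  · push Not at hchain
    obtain ⟨F, hF, G, hG, h1, h2⟩ := hchain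
    have h3 : monomialValue x f = 0 := by
      have hFG : F ≠ G := fun h => h1 h.le
      have h4 : Finsupp.single F 1 + Finsupp.single G 1 ≤ f := by
        intro H
        rw [Finsupp.mem_support_iff] at hF hG
        rw [Finsupp.add_apply]
        by_cases hHF : H = F
        · subst hHF
          rw [Finsupp.single_eq_same, Finsupp.single_eq_of_ne hFG]; omega
        · rw [Finsupp.single_eq_of_ne hHF]
          by_cases hHG : H = G
          · subst hHG
            rw [Finsupp.single_eq_same]; omega
          · rw [Finsupp.single_eq_of_ne hHG]; omega
      rw [← add_tsub_cancel_of_le h4, monomialValue_add, monomialValue_add, monomialValue_single,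
        monomialValue_single, pow_one, pow_one, hx.mul_eq_zero F G h1 h2, zero_mul]
    rw [h3]; exact Submodule.zero_mem _
  obtain ⟨a, F, r, g, c, haF, hr, hfg, hc⟩ := exists_of_not_isFY hx hbot hchain hf
  have hF : ⊥ < F := bot_le.trans_lt haF
  have hgbot : ⊥ ∉ g.support := by
    rw [Finsupp.notMem_support_iff] at hbot ⊢
    rw [hfg, Finsupp.add_apply] at hbot
    omega
  have h1 : monomialValue x f = -((upperSum x F ^ r - x F ^ r) * monomialValue x g) := by
    have h2 := hx.mul_upperSum_pow_grade haF hr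
    rw [hfg, monomialValue_add, monomialValue_single, hc]
    linear_combination c * h2
  rw [h1]
  refine Submodule.neg_mem _ ?_
  have h2 := mul_mem_weightSpan (upperSum_pow_sub_pow_mem (x := x) hF r)
    (monomialValue_mem_weightSpan (x := x) hgbot le_rfl)
  have hdeg : r + g.degree = f.degree := by rw [hfg, map_add, Finsupp.degree_single]
  have hw : r * grade ℕ F + 1 + gradeWeight g = gradeWeight f + 1 := by
    rw [hfg, map_add, gradeWeight_single]; ring
  rw [hdeg, hw] at h2
  refine (Submodule.span_le.2 ?_) h2
  rintro _ ⟨f', ⟨hf'bot, hf'd, hf'w⟩, rfl⟩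
  have hle := gradeWeight_le f'
  rw [hf'd] at hle
  have h3 := ih (f'.degree * grade ℕ (⊤ : Flats M) - gradeWeight f') (by rw [hf'd]; omega)
    hf'bot rfl
  rwa [hf'd] at h3

end Spanning

/-! ### The Hilbert series of the Chow ring -/

section HilbertSeries

open MvPolynomial

variable {α : Type*} {M : Matroid α} [M.Finite]

omit [M.Finite] in
lemma nonempty_iff_bot_lt [M.Loopless] (F : Flats M) : F.1.Nonempty ↔ ⊥ < F := by
  have h : (⊥ : Flats M).1 = ∅ := M.loops_eq_empty
  rw [bot_lt_iff_ne_bot, Set.nonempty_iff_ne_empty, ← h]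
  exact Subtype.coe_injective.ne_iff

/-- The class of the generator `x_F` in the Chow ring, and `1` for the empty flat. -/
def chowGen (M : Matroid α) [M.Finite] (F : Flats M) : ChowRing M :=
  if h : F.1.Nonempty then Ideal.Quotient.mk (chowIdeal M) (X ⟨F, h⟩) else 1

lemma chowGen_coe (F : NonemptyFlats M) :
    chowGen M F.1 = Ideal.Quotient.mk (chowIdeal M) (X F) := dif_pos F.2

lemma sum_nonemptyFlats {B : Type*} [AddCommMonoid B] (e : α) (y : Flats M → B) :
    ∑ F : NonemptyFlats M with e ∈ F.1.1, y F.1 = ∑ F with e ∈ F.1, y F := by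
  refine Finset.sum_nbij Subtype.val (fun F hF => ?_) Subtype.val_injective.injOn
    (fun F hF => ?_) fun _ _ => rfl
  · simpa using hF
  · have : e ∈ F.1 := by simpa using hF
    exact ⟨⟨F, e, this⟩, by simpa using this, rfl⟩

lemma isChowFamily_chowGen [M.Loopless] : IsChowFamily (chowGen M) where
  bot := dif_neg fun h => ((nonempty_iff_bot_lt _).1 h).false
  mul_eq_zero F G h1 h2 := by
    have hF : F.1.Nonempty := (nonempty_iff_bot_lt F).2
      (bot_lt_iff_ne_bot.2 fun h => h1 (h ▸ bot_le))
    have hG : G.1.Nonempty := (nonempty_iff_bot_lt G).2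
      (bot_lt_iff_ne_bot.2 fun h => h2 (h ▸ bot_le))
    rw [chowGen_coe ⟨F, hF⟩, chowGen_coe ⟨G, hG⟩, ← map_mul, Ideal.Quotient.eq_zero_iff_mem]
    exact Ideal.subset_span (Or.inl ⟨⟨F, hF⟩, ⟨G, hG⟩, h1, h2, rfl⟩)
  sum_eq_zero e he := by
    rw [← sum_nonemptyFlats, Finset.sum_congr rfl fun F _ => chowGen_coe F, ← map_sum,
      Ideal.Quotient.eq_zero_iff_mem]
    exact Ideal.subset_span (Or.inr ⟨e, he, rfl⟩)

lemma monomialValue_mapDomain (m : NonemptyFlats M →₀ ℕ) :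
    monomialValue (chowGen M) (m.mapDomain Subtype.val) =
      Ideal.Quotient.mk (chowIdeal M) (monomial m 1) := by
  rw [monomialValue, Finsupp.prod_mapDomain_index_inj Subtype.val_injective, monomial_eq, C_1,
    one_mul, map_finsuppProd]
  simp only [chowGen_coe, map_pow]

omit [M.Finite] in
lemma exists_mapDomain_eq [M.Loopless] {f : Flats M →₀ ℕ} (hf : ⊥ ∉ f.support) :
    ∃ m : NonemptyFlats M →₀ ℕ, m.mapDomain Subtype.val = f :=
  ⟨_, Finsupp.mapDomain_comapDomain _ Subtype.val_injective f fun F hF =>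
    ⟨⟨F, (nonempty_iff_bot_lt F).2 (bot_lt_iff_ne_bot.2 fun h => hf (h ▸ hF))⟩, rfl⟩⟩

omit [M.Finite] in
lemma bot_notMem_support_mapDomain [M.Loopless] (m : NonemptyFlats M →₀ ℕ) :
    ⊥ ∉ (m.mapDomain Subtype.val : Flats M →₀ ℕ).support := by
  intro h
  obtain ⟨F, _, hF⟩ := Finset.mem_image.1 (Finsupp.mapDomain_support h)
  exact ((nonempty_iff_bot_lt _).1 (hF ▸ F.2)).false

lemma IsFY.bot_notMem {f : Flats M →₀ ℕ} (hf : IsFY ⊥ f) : ⊥ ∉ f.support :=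
  fun h => (hf.lt _ h).false

lemma chowPiece_eq_span [M.Loopless] (d : ℕ) : chowPiece M d =
    Submodule.span ℚ (monomialValue (chowGen M) '' {f | IsFY ⊥ f ∧ f.degree = d}) := by
  refine le_antisymm ?_ (Submodule.span_le.2 ?_)
  · rintro _ ⟨p, hp, rfl⟩
    have hp : p.IsHomogeneous d := hp
    rw [← support_sum_monomial_coeff p, map_sum]
    refine Submodule.sum_mem _ fun m hm => ?_
    have hd : m.degree = d := by
      by_contra h
      exact mem_support_iff.1 hm (hp.coeff_eq_zero h)
    have h1 : monomial m (p.coeff m) = p.coeff m • monomial m (1 : ℚ) := by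
      rw [smul_monomial, smul_eq_mul, mul_one]
    rw [h1, map_smul]
    refine Submodule.smul_mem _ _ ?_
    have h2 := isChowFamily_chowGen.monomialValue_mem_span (bot_notMem_support_mapDomain m)
    rw [Finsupp.degree_mapDomain, hd, monomialValue_mapDomain] at h2
    exact h2
  · rintro _ ⟨f, ⟨hf, rfl⟩, rfl⟩
    obtain ⟨m, rfl⟩ := exists_mapDomain_eq hf.bot_notMem
    rw [monomialValue_mapDomain]
    exact ⟨monomial m 1, isHomogeneous_monomial 1 (by rw [Finsupp.degree_mapDomain]), rfl⟩

/-- The polynomials in the radical of the degree pairing. -/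
def degreeRadical (M : Matroid α) [M.Finite] : Ideal (MvPolynomial (Flats M) ℚ) where
  carrier := {p | ∀ z, degreeMap ⊥ (z * p) = 0}
  zero_mem' := by simp
  add_mem' hp hq z := by rw [mul_add, map_add, hp z, hq z, add_zero]
  smul_mem' c p hp z := by rw [smul_eq_mul, ← mul_assoc]; exact hp _

lemma rename_mem_degreeRadical [M.Loopless] {p : MvPolynomial (NonemptyFlats M) ℚ}
    (hp : p ∈ chowIdeal M) : rename Subtype.val p ∈ degreeRadical M := by
  suffices chowIdeal M ≤ (degreeRadical M).comap (rename (R := ℚ) Subtype.val) from this hp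
  refine Ideal.span_le.2 ?_
  rintro _ (⟨F, G, h1, h2, rfl⟩ | ⟨e, he, rfl⟩) z
  · have h : rename Subtype.val (X F * X G) = (X F.1 * X G.1 : MvPolynomial (Flats M) ℚ) := by
      rw [map_mul, rename_X, rename_X]
    change degreeMap ⊥ (z * rename Subtype.val (X F * X G)) = 0
    rw [h, X, X, monomial_mul, one_mul]
    exact degreeMap_mul_of_incomparable h1 h2 ⊥ (by simp) (by simp) z
  · have h : rename Subtype.val (∑ F : NonemptyFlats M with e ∈ F.1.1, X F) =
        linForm (⊥ : Flats M) e := by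
      rw [map_sum, Finset.sum_congr rfl fun F _ => rename_X _ F,
        sum_nonemptyFlats e fun F => (X F : MvPolynomial (Flats M) ℚ), linForm]
      refine Finset.sum_congr (Finset.filter_congr fun F _ => ?_) fun _ _ => rfl
      rw [iff_and_self]
      exact fun h => (nonempty_iff_bot_lt F).1 ⟨e, h⟩
    change degreeMap ⊥ (z * rename Subtype.val _) = 0
    rw [h]
    refine degreeMap_mul_linForm he ?_ z
    have : (⊥ : Flats M).1 = ∅ := M.loops_eq_empty
    rw [this]; exact Set.notMem_empty e

lemma linearIndependent_monomialValue [M.Loopless] (hM : (⊥ : Flats M) < ⊤) :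
    LinearIndependent ℚ fun f : {f : Flats M →₀ ℕ // f ∈ fySet ⊥} =>
      monomialValue (chowGen M) f.1 := by
  rw [Fintype.linearIndependent_iff]
  intro c hc f₀
  have hm : ∀ f : {f : Flats M →₀ ℕ // f ∈ fySet ⊥}, ∃ m : NonemptyFlats M →₀ ℕ,
      m.mapDomain Subtype.val = f.1 := fun f => exists_mapDomain_eq (mem_fySet.1 f.2).bot_notMem
  choose m hm using hm
  have h1 : ∑ f, monomial (m f) (c f) ∈ chowIdeal M := by
    rw [← Ideal.Quotient.eq_zero_iff_mem, map_sum, ← hc]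
    refine Finset.sum_congr rfl fun f _ => ?_
    rw [← hm f, monomialValue_mapDomain]
    have h2 : monomial (m f) (c f) = c f • monomial (m f) (1 : ℚ) := by
      rw [smul_monomial, smul_eq_mul, mul_one]
    rw [h2]; rfl
  have h2 := rename_mem_degreeRadical h1
  rw [map_sum] at h2
  simp only [rename_monomial, hm] at h2
  have hcoeff : ∀ g, (∑ f : {f : Flats M →₀ ℕ // f ∈ fySet ⊥}, monomial f.1 (c f)).coeff g =
      ∑ f : {f : Flats M →₀ ℕ // f ∈ fySet ⊥}, if f.1 = g then c f else 0 := by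
    intro g
    rw [coeff_sum]
    exact Finset.sum_congr rfl fun f _ => coeff_monomial _ _ _
  have h3 := eq_zero_of_degreeMap_mul_eq_zero hM
    (p := ∑ f : {f : Flats M →₀ ℕ // f ∈ fySet ⊥}, monomial f.1 (c f)) ?_
    fun z => by rw [mul_comm]; exact h2 z
  · have h4 := hcoeff f₀.1
    rw [h3, coeff_zero, Finset.sum_eq_single f₀, if_pos rfl] at h4
    · exact h4.symm
    · exact fun f _ hf => if_neg fun h => hf (Subtype.ext h)
    · simp
  · intro g hg
    rw [mem_support_iff, hcoeff] at hg
    obtain ⟨f, _, hf⟩ := Finset.exists_ne_zero_of_sum_ne_zero hg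
    have : f.1 = g := by by_contra h; simp [h] at hf
    exact this ▸ mem_fySet.1 f.2

/-- The Feichtner–Yuzvinsky monomials form a basis of the Chow ring. -/
theorem finrank_chowPiece [M.Loopless] (hM : (⊥ : Flats M) < ⊤) (d : ℕ) :
    Module.finrank ℚ (chowPiece M d) =
      ((fySet (⊥ : Flats M)).filter fun f => f.degree = d).card := by
  set s := (fySet (⊥ : Flats M)).filter fun f => f.degree = d with hs
  have hv : LinearIndependent ℚ fun f : s => monomialValue (chowGen M) f.1 :=
    (linearIndependent_monomialValue hM).comp
      (fun f : s => ⟨f.1, (Finset.mem_filter.1 f.2).1⟩)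
      fun f g h => Subtype.ext (Subtype.mk.inj h)
  have hrange : Set.range (fun f : s => monomialValue (chowGen M) f.1) =
      monomialValue (chowGen M) '' {f | IsFY ⊥ f ∧ f.degree = d} := by
    ext y
    simp [hs, mem_fySet, and_assoc]
  rw [chowPiece_eq_span, ← hrange, finrank_span_eq_card hv, Fintype.card_coe]

theorem chowHilbertSeries_eq [M.Loopless] (hM : (⊥ : Flats M) < ⊤) :
    chowHilbertSeries M = ((fyPoly (⊥ : Flats M) : Polynomial ℤ) : PowerSeries ℤ) := by
  ext d
  rw [chowHilbertSeries, PowerSeries.coeff_mk, Polynomial.coeff_coe, coeff_fyPoly,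
    finrank_chowPiece hM]

end HilbertSeries

end ChowPoly

end

theorem theorem1 :
    (∀ {α : Type*} (M : Matroid α) [M.Finite] [M.Loopless] (n : ℕ), 0 < n → M.eRank = (n : ℕ∞) →
      (∃ lam : ChowPoly.Flats M → ChowPoly.Flats M → ℕ, ChowPoly.IsRLabeling lam) ∧
      ∀ lam : ChowPoly.Flats M → ChowPoly.Flats M → ℕ, ChowPoly.IsRLabeling lam →
        ChowPoly.chowHilbertSeries M =
          ((ChowPoly.descentSum lam n : Polynomial ℤ) : PowerSeries ℤ)) ∧
    (∀ {P : Type*} [PartialOrder P] [Fintype P] [BoundedOrder P] [GradeMinOrder ℕ P],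
      0 < ChowPoly.posetRank P →
      ∀ lam : P → P → ℕ, ChowPoly.IsRLabeling lam →
        ChowPoly.chowPolynomial P = ChowPoly.descentSum lam (ChowPoly.posetRank P)) := by
  constructor
  · intro α M _ _ n hn hM
    refine ⟨ChowPoly.exists_isRLabeling, fun lam hlam => ?_⟩
    have hrank : ChowPoly.posetRank (ChowPoly.Flats M) = n := ChowPoly.posetRank_flats hM
    have hbot : (⊥ : ChowPoly.Flats M) < ⊤ := by
      refine bot_lt_iff_ne_bot.2 fun h => ?_
      rw [ChowPoly.posetRank, h, grade_bot] at hrank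
      exact hn.ne hrank
    rw [ChowPoly.chowHilbertSeries_eq hbot, ← hrank, ChowPoly.descentSum_eq_upperDescentSum,
      ChowPoly.eq_of_recursion ChowPoly.fyPoly_eq hlam.upperDescentSum_eq]
  · intro P _ _ _ _ hP lam hlam
    rw [ChowPoly.descentSum_eq_upperDescentSum,
      ChowPoly.chowPolynomial_eq_of_recursion hlam.upperDescentSum_eq hP]
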